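/- Let $G$ be a finite simple graph that is subcubic (every vertex has degree at most $3$), triangle-free and outerplanar (it has a planar drawing in which all vertices belong to the outer face). Then $G$ is $(1,2,2,2)$-packing colorable: there is a map $c:V(G)\to\{1,2,3,4\}$ such that any two distinct vertices $x,y$ with $c(x)=c(y)=1$ satisfy $d_G(x,y)>1$ (color $1$ forms an independent set), and any two distinct vertices $x,y$ with $c(x)=c(y)\in\{2,3,4\}$ satisfy $d_G(x,y)>2$ (each of the other three colors forms a $2$-packing). Here $d_G$ is the length of a shortest path, and $d_G(x,y)=\infty$ if $x$ and $y$ lie in different components. -/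

import Mathlib

open Set

/-- The Euclidean plane. -/
abbrev Plane : Type := EuclideanSpace ℝ (Fin 2)

/-- A planar drawing of a graph `G`: distinct vertices are distinct points of the plane, every edge
is a simple continuous arc joining its two end vertices, no vertex lies in the interior of an arc,
and the interiors of two different arcs are disjoint. -/
structure PlanarDrawing {V : Type*} (G : SimpleGraph V) where
  /-- the point of the plane at which a vertex is drawn -/
  point : V → Plane
  point_injective : Function.Injective point
  /-- the arc along which an edge is drawn -/
  arc : G.edgeSet → unitInterval → Plane
  arc_continuous : ∀ e, Continuous (arc e)
  arc_injective : ∀ e, Function.Injective (arc e)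
  arc_ends : ∀ e, Sym2.map point e.1 = s(arc e 0, arc e 1)
  arc_ne_point : ∀ e, ∀ t ∈ Ioo (0 : unitInterval) 1, ∀ v, arc e t ≠ point v
  arc_ne_arc : ∀ e e', e ≠ e' → ∀ t ∈ Ioo (0 : unitInterval) 1, ∀ t' ∈ Ioo (0 : unitInterval) 1,
    arc e t ≠ arc e' t'

namespace PlanarDrawing

variable {V : Type*} {G : SimpleGraph V}

/-- The set of all points of the plane that are covered by the drawing. -/
def carrier (D : PlanarDrawing G) : Set Plane :=
  range D.point ∪ ⋃ e, range (D.arc e)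

/-- The faces of a drawing are the connected components of the complement of the drawing. -/
def IsFace (D : PlanarDrawing G) (F : Set Plane) : Prop :=
  ∃ x ∈ D.carrierᶜ, F = connectedComponentIn D.carrierᶜ x

/-- The outer face is the unbounded face. -/
def IsOuterFace (D : PlanarDrawing G) (F : Set Plane) : Prop :=
  D.IsFace F ∧ ¬ Bornology.IsBounded F

end PlanarDrawing

namespace SimpleGraph

variable {V : Type*}

/-- A graph is outerplanar if it has a planar drawing in which all vertices belong to (that is, lie
on the boundary of) the outer face. -/
def IsOuterplanar (G : SimpleGraph V) : Prop :=
  ∃ (D : PlanarDrawing G) (F : Set Plane), D.IsOuterFace F ∧ ∀ v, D.point v ∈ frontier F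

/-- A set `A` of vertices is a `d`-packing if any two distinct vertices of `A` are at distance
greater than `d` (vertices in different components are at distance `∞`). -/
def IsPacking (G : SimpleGraph V) (d : ℕ) (A : Set V) : Prop :=
  ∀ x ∈ A, ∀ y ∈ A, x ≠ y → (d : ℕ∞) < G.edist x y

/-- `c` is an `S`-packing coloring for `S = (s 0, …, s (k - 1))`: each color class `i` is an
`s i`-packing. -/
def IsPackingColoring (G : SimpleGraph V) {k : ℕ} (s : Fin k → ℕ) (c : V → Fin k) : Prop :=
  ∀ i, G.IsPacking (s i) (c ⁻¹' {i})

/-- `G` is `S`-packing colorable if it has an `S`-packing coloring. -/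
def IsPackingColorable (G : SimpleGraph V) {k : ℕ} (s : Fin k → ℕ) : Prop :=
  ∃ c : V → Fin k, G.IsPackingColoring s c

/-- A graph is subcubic if all its vertices have degree at most `3`. -/
def IsSubcubic (G : SimpleGraph V) [G.LocallyFinite] : Prop :=
  ∀ v, G.degree v ≤ 3

end SimpleGraph

/-! Topology enters only through `not_exists_K23`: with a K₂,₃ minor, a point of the outer face
joined to the three middle branch sets would give a K₃,₃ in the plane without two independent edges
that meet. A parity count of winding numbers excludes this (`not_exists_drawing_K33`).

The rest is induction over vertex sets `S`, with the stronger claim `Reducible`. An edge at the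
prescribed vertex, or the prescribed edge itself, is either a bridge of the graph on `S`, and
colorings of the two sides are renamed until they fit, or it lies on a chordless cycle of length at
least four. If the cycle is all of `S`, it is colored explicitly. Otherwise let `D` be a component
of the rest. As there is no K₂,₃ minor, the cycle vertices attached to `D` are pairwise adjacent, so
by triangle-freeness there are at most two of them; by subcubicity each sends one edge to `D`.

The main case has two attachment vertices `w`, `w'` (`AttachedAt.extendable`). The graph on `D` with
`w`, `w'` is smaller than `S`, and `w`, `w'` have degree two in it, so induction gives a coloring
that matches a given one at `w` and `w'`: `Centered` serves if one of them has color 0, `Paired` if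
neither has. The latter needs a 0 on the remaining neighbor of `w` or of `w'`, and this is exactly
what the path clause of `Good` provides. -/

/-! ### Logarithms along plane curves and K₃,₃. -/

theorem exists_continuous_log {X : Type*} [TopologicalSpace X] [SimplyConnectedSpace X]
    [LocallyPathConnectedSpace X] {f : X → ℂ} (hf : Continuous f) (h0 : ∀ x, f x ≠ 0) (x₀ : X) :
    ∃ L : X → ℂ, Continuous L ∧ ∀ x, Complex.exp (L x) = f x := by
  obtain ⟨F, ⟨-, hF⟩, -⟩ := Complex.isCoveringMapOn_exp.existsUnique_continuousMap_lifts
    ⟨f, hf⟩ (a₀ := x₀) (Complex.exp_log (h0 x₀)) h0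
  exact ⟨F, F.continuous, fun x => congrFun hF x⟩

/-- Up to a constant, `M` and `N` lift the same curve through the covering exp. The factor `c`
admits the sign -1 of a reversed difference. -/
theorem log_increment_unique {M N : ℝ → ℂ} (hM : Continuous M) (hN : Continuous N) {c : ℂ}
    (h : ∀ t, Complex.exp (M t) = c * Complex.exp (N t)) : M 1 - M 0 = N 1 - N 0 := by
  have key : M = fun t => N t + (M 0 - N 0) := by
    refine Complex.isCoveringMap_exp.eq_of_comp_eq hM (by fun_prop) ?_ 0 (by simp)
    funext t
    apply Subtype.ext
    change Complex.exp (M t) = Complex.exp (N t + (M 0 - N 0))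
    rw [Complex.exp_add, Complex.exp_sub, h t, h 0]
    field_simp [Complex.exp_ne_zero]
  have := congrFun key 1
  rw [this]; ring

/-- The change of the logarithm of `γ t - v` along a curve `γ` that avoids `v`. -/
theorem exists_log_increment {γ : ℝ → ℂ} (hγ : Continuous γ) (v : ℂ) :
    ∃ δ : ℂ, (∀ t, γ t ≠ v) → Complex.exp δ * (γ 0 - v) = γ 1 - v ∧
      ∀ (M : ℝ → ℂ) (c : ℂ), Continuous M → (∀ t, Complex.exp (M t) = c * (γ t - v)) →
        M 1 - M 0 = δ := by
  by_cases h : ∀ t, γ t ≠ v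
  · obtain ⟨L, hL, hexp⟩ := exists_continuous_log (f := fun t => γ t - v) (by fun_prop)
      (fun t => sub_ne_zero.2 (h t)) 0
    refine ⟨L 1 - L 0, fun _ => ⟨?_, fun M c hM hc => ?_⟩⟩
    · rw [Complex.exp_sub, ← hexp 0, ← hexp 1]
      field_simp [Complex.exp_ne_zero]
    · exact log_increment_unique hM hL (c := c) fun t => by rw [hc t, hexp t]
  · exact ⟨0, fun h' => absurd h' h⟩

theorem int_of_two_pi_I_mul_eq_zero {z : ℤ} (h : (z : ℂ) * (Real.pi * Complex.I) = 0) : z = 0 := by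
  have := Complex.I_ne_zero
  have h2 : (Real.pi : ℂ) ≠ 0 := by exact_mod_cast Real.pi_ne_zero
  simpa [this, h2] using h

theorem exists_antisymmetric_log (h : Fin 3 → ℂ) (hh : Function.Injective h) :
    ∃ l : Fin 3 → Fin 3 → ℂ, (∀ i k, i ≠ k → Complex.exp (l i k) = h k - h i) ∧
      ∀ i k, i < k → l k i = l i k + Real.pi * Complex.I := by
  refine ⟨fun i k => if i < k then Complex.log (h k - h i)
    else Complex.log (h i - h k) + Real.pi * Complex.I, fun i k hik => ?_, fun i k hik => ?_⟩
  · have h1 : h k - h i ≠ 0 := sub_ne_zero.2 fun e => hik (hh e).symm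
    have h2 : h i - h k ≠ 0 := sub_ne_zero.2 fun e => hik (hh e)
    dsimp only
    split_ifs
    · exact Complex.exp_log h1
    · rw [Complex.exp_add, Complex.exp_log h2, Complex.exp_pi_mul_I]; ring
  · simp [hik, hik.not_gt]

/-- A drawing of the complete bipartite graph `K₃,₃` in the plane has two independent edges
that meet. -/
theorem not_exists_drawing_K33 (h x : Fin 3 → ℂ) (γ : Fin 3 → Fin 3 → ℝ → ℂ)
    (hγ : ∀ i j, Continuous (γ i j)) (h0 : ∀ i j, γ i j 0 = h i) (h1 : ∀ i j, γ i j 1 = x j)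
    (hind : ∀ i j k l, i ≠ k → j ≠ l → ∀ s t, γ i j s ≠ γ k l t) : False := by
  have hother : ∀ j : Fin 3, ∃ l, j ≠ l := by decide
  have hh : ∀ i k l, i ≠ k → ∀ t, γ k l t ≠ h i := fun i k l hik t => by
    obtain ⟨j, hj⟩ := hother l
    rw [← h0 i j]; exact hind k l i j hik.symm hj t 0
  have hx : ∀ j k l, j ≠ l → ∀ t, γ k l t ≠ x j := fun j k l hjl t => by
    obtain ⟨i, hi⟩ := hother k
    rw [← h1 i j]; exact hind k l i j hi hjl.symm t 1
  have hhx : ∀ i j, x j ≠ h i := fun i j => by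
    obtain ⟨k, hk⟩ := hother i
    rw [← h1 k j]; exact hh i k j hk 1
  have hhinj : Function.Injective h := fun i k e => by
    by_contra hik
    refine hh i k 0 hik 0 ?_
    rw [h0, e]
  have hxinj : Function.Injective x := fun j l e => by
    by_contra hjl
    refine hx j 0 l hjl 1 ?_
    rw [h1, e]
  obtain ⟨lam, hlam, hlam'⟩ := exists_antisymmetric_log h hhinj
  obtain ⟨mu, hmu, hmu'⟩ := exists_antisymmetric_log x hxinj
  set nu : Fin 3 → Fin 3 → ℂ := fun i j => Complex.log (x j - h i) with hnudef
  have hnu : ∀ i j, Complex.exp (nu i j) = x j - h i := fun i j =>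
    Complex.exp_log (sub_ne_zero.2 (hhx i j))
  choose A hA using fun i k l => exists_log_increment (hγ k l) (h i)
  choose B hB using fun j k l => exists_log_increment (hγ k l) (x j)
  -- The difference of two independent edges has a logarithm `L` on the whole parameter plane; its
  -- increment from (0,0) to (1,1) is the same along either pair of sides of the unit square.
  have hrel : ∀ i j k l, i ≠ k → j ≠ l → A i k l + B l i j = A k i j + B j k l := by
    intro i j k l hik hjl
    obtain ⟨L, hL, hexp⟩ := exists_continuous_log (X := ℝ × ℝ)
      (f := fun p => γ i j p.1 - γ k l p.2)
      (((hγ i j).comp continuous_fst).sub ((hγ k l).comp continuous_snd))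
      (fun p => sub_ne_zero.2 (hind i j k l hik hjl _ _)) (0, 0)
    have e1 := (hA i k l (hh i k l hik)).2 (fun t => L (0, t)) (-1) (by fun_prop)
      (fun t => by rw [hexp]; simp only [h0]; ring)
    have e2 := (hB j k l (hx j k l hjl)).2 (fun t => L (1, t)) (-1) (by fun_prop)
      (fun t => by rw [hexp]; simp only [h1]; ring)
    have e3 := (hA k i j (hh k i j hik.symm)).2 (fun t => L (t, 0)) 1 (by fun_prop)
      (fun t => by rw [hexp]; simp only [h0]; ring)
    have e4 := (hB l i j (hx l i j hjl.symm)).2 (fun t => L (t, 1)) 1 (by fun_prop)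
      (fun t => by rw [hexp]; simp only [h1]; ring)
    rw [← e1, ← e2, ← e3, ← e4]; ring
  -- End points determine the increments up to multiples of 2πi; these integers are what the parity
  -- count is about.
  have hn : ∀ i k l, ∃ n : ℤ, i ≠ k → A i k l = nu i l - lam i k + n * (2 * Real.pi * Complex.I) := by
    intro i k l
    by_cases hik : i = k
    · exact ⟨0, fun h => absurd hik h⟩
    have e := (hA i k l (hh i k l hik)).1
    rw [h0, h1, ← hlam i k hik, ← hnu, ← Complex.exp_add] at e
    obtain ⟨n, hn⟩ := Complex.exp_eq_exp_iff_exists_int.1 e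
    exact ⟨n, fun _ => by linear_combination hn⟩
  have hm : ∀ j k l, ∃ n : ℤ, j ≠ l →
      B j k l = mu j l - nu k j - Real.pi * Complex.I + n * (2 * Real.pi * Complex.I) := by
    intro j k l
    by_cases hjl : j = l
    · exact ⟨0, fun h => absurd hjl h⟩
    have e := (hB j k l (hx j k l hjl)).1
    have e' : h k - x j = Complex.exp (nu k j + Real.pi * Complex.I) := by
      rw [Complex.exp_add, hnu, Complex.exp_pi_mul_I]; ring
    rw [h0, h1, ← hmu j l hjl, e', ← Complex.exp_add] at e
    obtain ⟨n, hn⟩ := Complex.exp_eq_exp_iff_exists_int.1 e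
    exact ⟨n, fun _ => by linear_combination hn⟩
  choose n hn using hn
  choose m hm using hm
  -- The πi shifts of `lam` and `mu` add up to the 1 here; for the opposite order of `j`, `l` they
  -- cancel.
  have hpar : ∀ i j k l, i < k → j < l → 1 + n i k l + m l i j - n k i j - m j k l = 0 := by
    intro i j k l hik hjl
    have e := hrel i j k l hik.ne hjl.ne
    rw [hn i k l hik.ne, hm l i j hjl.ne', hn k i j hik.ne', hm j k l hjl.ne, hlam' i k hik,
      hmu' j l hjl] at e
    have := int_of_two_pi_I_mul_eq_zero (z := 2 * (1 + n i k l + m l i j - n k i j - m j k l))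
      (by push_cast; linear_combination e)
    omega
  have hpar' : ∀ i j k l, i < k → l < j → n i k l + m l i j - n k i j - m j k l = 0 := by
    intro i j k l hik hjl
    have e := hrel i j k l hik.ne hjl.ne'
    rw [hn i k l hik.ne, hm l i j hjl.ne, hn k i j hik.ne', hm j k l hjl.ne', hlam' i k hik,
      hmu' l j hjl] at e
    have := int_of_two_pi_I_mul_eq_zero (z := 2 * (n i k l + m l i j - n k i j - m j k l))
      (by push_cast; linear_combination e)
    omega
  have q01 : (0 : Fin 3) < 1 := by decide
  have q02 : (0 : Fin 3) < 2 := by decide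
  have q12 : (1 : Fin 3) < 2 := by decide
  have a1 := hpar 0 0 1 1 q01 q01
  have a2 := hpar 0 0 1 2 q01 q02
  have a3 := hpar 0 1 1 2 q01 q12
  have a4 := hpar 0 0 2 1 q02 q01
  have a5 := hpar 0 0 2 2 q02 q02
  have a6 := hpar 0 1 2 2 q02 q12
  have a7 := hpar 1 0 2 1 q12 q01
  have a8 := hpar 1 0 2 2 q12 q02
  have a9 := hpar 1 1 2 2 q12 q12
  have b1 := hpar' 0 1 1 0 q01 q01
  have b2 := hpar' 0 2 1 0 q01 q02
  have b3 := hpar' 0 2 1 1 q01 q12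
  have b4 := hpar' 0 1 2 0 q02 q01
  have b5 := hpar' 0 2 2 0 q02 q02
  have b6 := hpar' 0 2 2 1 q02 q12
  have b7 := hpar' 1 1 2 0 q12 q01
  have b8 := hpar' 1 2 2 0 q12 q02
  have b9 := hpar' 1 2 2 1 q12 q12
  -- Each integer `n` or `m` occurs in exactly two of the eighteen equations, so their sum modulo 2
  -- reads 9 = 0.
  clear hpar hpar' hn hm
  omega

/-- Only sets of independent edges have to be disjoint. This permits a hub whose three sets all
contain the outer face. -/
theorem not_joinedIn_K33 (h x : Fin 3 → Plane) (T : Fin 3 → Fin 3 → Set Plane)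
    (hT : ∀ i j, JoinedIn (T i j) (h i) (x j))
    (hdisj : ∀ i j k l, i ≠ k → j ≠ l → Disjoint (T i j) (T k l)) : False := by
  let φ : Plane → ℂ := fun p => ⟨p 0, p 1⟩
  have hφ : Continuous φ := by
    have : φ = fun p => (p 0 : ℂ) + (p 1 : ℂ) * Complex.I := by
      funext p; apply Complex.ext <;> simp [φ]
    rw [this]; fun_prop
  have hφi : Function.Injective φ := fun p q e => by
    have h0 := congrArg Complex.re e
    have h1 := congrArg Complex.im e
    simp only [φ] at h0 h1
    ext i
    fin_cases i
    · exact h0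
    · exact h1
  refine not_exists_drawing_K33 (fun i => φ (h i)) (fun j => φ (x j))
    (fun i j t => φ ((hT i j).somePath.extend t)) (fun i j => ?_) (fun i j => ?_) (fun i j => ?_)
    (fun i j k l hik hjl s t e => ?_)
  · exact hφ.comp (hT i j).somePath.continuous_extend
  · simp
  · simp
  · have hmem : ∀ i j t, (hT i j).somePath.extend t ∈ T i j := fun i j t =>
      (hT i j).somePath_mem _
    exact Set.disjoint_left.1 (hdisj i j k l hik hjl) (hmem i j s) (hφi e ▸ hmem k l t)

/-! ### Drawings of induced subgraphs and the absence of K₂,₃ minors. -/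

namespace SimpleGraph

/-- The edges of `G` with both ends in `S`, as a graph on the same vertex type. -/
def within {V : Type*} (G : SimpleGraph V) (S : Set V) : SimpleGraph V where
  Adj x y := G.Adj x y ∧ x ∈ S ∧ y ∈ S
  symm := ⟨fun _ _ h => ⟨h.1.symm, h.2.2, h.2.1⟩⟩
  loopless := ⟨fun _ h => G.irrefl h.1⟩

end SimpleGraph

namespace PlanarDrawing

variable {V : Type*} {G : SimpleGraph V}

/-- The part of the drawing that belongs to the subgraph induced on `Y`. -/
def carrierOn (D : PlanarDrawing G) (Y : Set V) : Set Plane :=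
  D.point '' Y ∪ ⋃ e ∈ {e : G.edgeSet | ∀ v ∈ e.1, v ∈ Y}, range (D.arc e)

theorem carrierOn_subset_carrier (D : PlanarDrawing G) (Y : Set V) : D.carrierOn Y ⊆ D.carrier := by
  apply union_subset_union
  · rintro _ ⟨v, -, rfl⟩; exact ⟨v, rfl⟩
  · exact iUnion_mono fun e => iUnion_subset fun _ => subset_rfl

theorem isClosed_carrierOn [Finite V] (D : PlanarDrawing G) (Y : Set V) :
    IsClosed (D.carrierOn Y) := by
  refine ((toFinite Y).image D.point).isClosed.union ?_
  exact (toFinite _).isClosed_biUnion fun e _ => (isCompact_range (D.arc_continuous e)).isClosed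

theorem isClosed_carrier [Finite V] (D : PlanarDrawing G) : IsClosed D.carrier := by
  refine (finite_range D.point).isClosed.union ?_
  exact isClosed_iUnion_of_finite fun e => (isCompact_range (D.arc_continuous e)).isClosed

theorem arc_zero_one (D : PlanarDrawing G) (e : G.edgeSet) :
    ∃ u v, e.1 = s(u, v) ∧ D.arc e 0 = D.point u ∧ D.arc e 1 = D.point v := by
  obtain ⟨e, he⟩ := e
  induction e using Sym2.ind with
  | _ u v =>
    have h := D.arc_ends ⟨s(u, v), he⟩
    simp only [Sym2.map_mk, Sym2.eq_iff] at h
    rcases h with ⟨h1, h2⟩ | ⟨h1, h2⟩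
    · exact ⟨u, v, rfl, h1.symm, h2.symm⟩
    · exact ⟨v, u, Sym2.eq_swap, h2.symm, h1.symm⟩

theorem mem_carrierOn_cases {D : PlanarDrawing G} {Y : Set V} {z : Plane} (hz : z ∈ D.carrierOn Y) :
    (∃ v ∈ Y, z = D.point v) ∨
      ∃ e : G.edgeSet, (∀ v ∈ e.1, v ∈ Y) ∧ ∃ t ∈ Ioo (0 : unitInterval) 1, z = D.arc e t := by
  rcases hz with ⟨v, hv, rfl⟩ | hz
  · exact .inl ⟨v, hv, rfl⟩
  · simp only [mem_iUnion] at hz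
    obtain ⟨e, he, t, rfl⟩ := hz
    obtain ⟨u, v, huv, h0, h1⟩ := D.arc_zero_one e
    by_cases ht0 : t = 0
    · exact .inl ⟨u, he u (by simp [huv]), by rw [ht0, h0]⟩
    by_cases ht1 : t = 1
    · exact .inl ⟨v, he v (by simp [huv]), by rw [ht1, h1]⟩
    exact .inr ⟨e, he, t, ⟨unitInterval.pos_iff_ne_zero.2 ht0, unitInterval.lt_one_iff_ne_one.2 ht1⟩,
      rfl⟩

theorem disjoint_carrierOn (D : PlanarDrawing G) {Y Z : Set V} (h : Disjoint Y Z) :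
    Disjoint (D.carrierOn Y) (D.carrierOn Z) := by
  refine Set.disjoint_left.2 fun z hY hZ => ?_
  rcases mem_carrierOn_cases hY with ⟨v, hv, rfl⟩ | ⟨e, he, t, ht, rfl⟩ <;>
  rcases mem_carrierOn_cases hZ with ⟨w, hw, hvw⟩ | ⟨f, hf, s, hs, hef⟩
  · exact Set.disjoint_left.1 h hv (D.point_injective hvw ▸ hw)
  · exact D.arc_ne_point f s hs v hef.symm
  · exact D.arc_ne_point e t ht w hvw
  · refine D.arc_ne_arc e f ?_ t ht s hs hef
    rintro rfl
    obtain ⟨u, v, huv, -⟩ := D.arc_zero_one e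
    exact Set.disjoint_left.1 h (he u (by simp [huv])) (hf u (by simp [huv]))

theorem point_mem_carrierOn (D : PlanarDrawing G) {Y : Set V} {v : V} :
    D.point v ∈ D.carrierOn Y ↔ v ∈ Y := by
  refine ⟨fun h => ?_, fun h => .inl ⟨v, h, rfl⟩⟩
  rcases mem_carrierOn_cases h with ⟨w, hw, e⟩ | ⟨e, -, t, ht, he⟩
  · exact D.point_injective e ▸ hw
  · exact absurd he.symm (D.arc_ne_point e t ht v)

theorem joinedIn_of_adj (D : PlanarDrawing G) {Y : Set V} {a b : V} (h : (G.within Y).Adj a b) :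
    JoinedIn (D.carrierOn Y) (D.point a) (D.point b) := by
  let e : G.edgeSet := ⟨s(a, b), h.1⟩
  have he : ∀ v ∈ e.1, v ∈ Y := by
    intro v hv
    rcases Sym2.mem_iff.1 hv with rfl | rfl
    exacts [h.2.1, h.2.2]
  have hj : JoinedIn (D.carrierOn Y) (D.arc e 0) (D.arc e 1) :=
    ⟨⟨⟨D.arc e, D.arc_continuous e⟩, rfl, rfl⟩, fun t =>
      .inr (mem_biUnion (x := e) he ⟨t, rfl⟩)⟩
  obtain ⟨u, v, huv, h0, h1⟩ := D.arc_zero_one e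
  rw [h0, h1] at hj
  rcases Sym2.eq_iff.1 huv with ⟨rfl, rfl⟩ | ⟨rfl, rfl⟩
  exacts [hj, hj.symm]

theorem joinedIn_of_reachable (D : PlanarDrawing G) {Y : Set V} {a b : V} (ha : a ∈ Y)
    (h : (G.within Y).Reachable a b) : JoinedIn (D.carrierOn Y) (D.point a) (D.point b) := by
  obtain ⟨w⟩ := h
  induction w with
  | nil => exact JoinedIn.refl (D.point_mem_carrierOn.2 ha)
  | cons hadj _ ih => exact (D.joinedIn_of_adj hadj).trans (ih hadj.2.2)

end PlanarDrawing

/-- An outerplanar graph has no `K₂,₃` minor. -/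
theorem SimpleGraph.IsOuterplanar.not_exists_K23 {V : Type*} [Finite V] {G : SimpleGraph V}
    (hout : G.IsOuterplanar) {a b : V} (hab : a ≠ b) (X : Fin 3 → Set V)
    (hX : ∀ i j, i ≠ j → Disjoint (X i) (X j)) (ha : ∀ i, a ∉ X i) (hb : ∀ i, b ∉ X i) (x : Fin 3 → V)
    (hx : ∀ i, x i ∈ X i) (hra : ∀ i, (G.within (insert a (X i))).Reachable a (x i))
    (hrb : ∀ i, (G.within (insert b (X i))).Reachable b (x i)) : False := by
  obtain ⟨D, F, ⟨⟨o, ho, hF⟩, -⟩, hfr⟩ := hout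
  let K : V → Fin 3 → Set Plane := fun v i => D.carrierOn (insert v (X i))
  have hopen : IsOpen F := by
    rw [hF]; exact D.isClosed_carrier.isOpen_compl.connectedComponentIn
  have hoF : o ∈ F := by rw [hF]; exact mem_connectedComponentIn ho
  have hFc : Disjoint F D.carrier := by
    rw [hF]; exact disjoint_compl_left.mono_left (connectedComponentIn_subset _ _)
  have hconn : IsConnected F := by
    rw [hF]; exact isConnected_connectedComponentIn_iff.2 ho
  have hpath : IsPathConnected F := hopen.isConnected_iff_isPathConnected.1 hconn
  have hxne : ∀ v i j, i ≠ j → v ≠ x i → x i ∉ insert v (X j) := by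
    rintro v i j hij hv (h | h)
    · exact hv h.symm
    · exact Set.disjoint_left.1 (hX i j hij) (hx i) h
  have hax : ∀ i, a ≠ x i := fun i h => ha i (h ▸ hx i)
  have hbx : ∀ i, b ≠ x i := fun i h => hb i (h ▸ hx i)
  -- The point `x i` is only on the frontier of `F`; a disc missing the other, closed, branches
  -- bridges the gap.
  have hball : ∀ i, ∃ r > 0, ∀ j, i ≠ j →
      Disjoint (Metric.ball (D.point (x i)) r) (K a j ∪ K b j) := by
    intro i
    have hcl : IsClosed (⋃ j ∈ {j | i ≠ j}, (K a j ∪ K b j)) :=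
      (toFinite _).isClosed_biUnion fun j _ => (D.isClosed_carrierOn _).union (D.isClosed_carrierOn _)
    have hnot : D.point (x i) ∈ (⋃ j ∈ {j | i ≠ j}, (K a j ∪ K b j))ᶜ := by
      simp only [mem_compl_iff, mem_iUnion, not_exists]
      rintro j hj (h | h)
      · exact hxne a i j hj (hax i) (D.point_mem_carrierOn.1 h)
      · exact hxne b i j hj (hbx i) (D.point_mem_carrierOn.1 h)
    obtain ⟨r, hr, hsub⟩ := Metric.isOpen_iff.1 hcl.isOpen_compl _ hnot
    exact ⟨r, hr, fun j hj => Set.disjoint_left.2 fun z hz hz' => hsub hz (mem_biUnion (x := j) hj hz')⟩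
  choose r hr hball using hball
  -- The third hub `o` reaches `x i` through `B i`. If `B i` meets `K a i` or `K b i`, no harm is
  -- done, as these edges share the end `x i`.
  let B : Fin 3 → Set Plane := fun i => F ∪ Metric.ball (D.point (x i)) (r i)
  have hjo : ∀ i, JoinedIn (B i) o (D.point (x i)) := by
    intro i
    obtain ⟨z, hzb, hzF⟩ := mem_closure_iff.1 (frontier_subset_closure (hfr (x i))) _
      Metric.isOpen_ball (Metric.mem_ball_self (hr i))
    refine ((hpath.joinedIn o hoF z hzF).mono subset_union_left).trans ?_
    exact JoinedIn.mono (JoinedIn.of_segment_subset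
      ((convex_ball _ _).segment_subset hzb (Metric.mem_ball_self (hr i)))) subset_union_right
  have hBK : ∀ i j, i ≠ j → Disjoint (B i) (K a j ∪ K b j) := fun i j hij =>
    Set.disjoint_union_left.2 ⟨hFc.mono_right (union_subset (D.carrierOn_subset_carrier _)
      (D.carrierOn_subset_carrier _)), hball i j hij⟩
  have hKK : ∀ i j, i ≠ j → Disjoint (K a i) (K b j) := fun i j hij => by
    refine D.disjoint_carrierOn (Set.disjoint_left.2 ?_)
    rintro v (rfl | hv) (h | h)
    · exact hab h
    · exact ha j h
    · exact hb i (h ▸ hv)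
    · exact Set.disjoint_left.1 (hX i j hij) hv h
  have hBa : ∀ i j, i ≠ j → Disjoint (B i) (K a j) := fun i j hij =>
    (hBK i j hij).mono_right subset_union_left
  have hBb : ∀ i j, i ≠ j → Disjoint (B i) (K b j) := fun i j hij =>
    (hBK i j hij).mono_right subset_union_right
  refine not_joinedIn_K33 ![D.point a, D.point b, o] (fun j => D.point (x j)) ![K a, K b, B]
    (fun i j => ?_) (fun i j k l hik hjl => ?_)
  · fin_cases i
    · exact D.joinedIn_of_reachable (mem_insert _ _) (hra j)
    · exact D.joinedIn_of_reachable (mem_insert _ _) (hrb j)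
    · exact hjo j
  · fin_cases i <;> fin_cases k <;> first
      | exact absurd rfl hik
      | exact hKK j l hjl
      | exact (hKK l j hjl.symm).symm
      | exact hBa j l hjl
      | exact (hBa l j hjl.symm).symm
      | exact hBb j l hjl
      | exact (hBb l j hjl.symm).symm

/-! ### Good colorings and gluing. -/

namespace SimpleGraph

variable {V : Type*} {G : SimpleGraph V} {S A B D : Finset V} {c c' : V → Fin 4}

/-- `v` has at most `k` neighbours in `S`. -/
def DegreeLE (G : SimpleGraph V) (S : Finset V) (k : ℕ) (v : V) : Prop :=
  ∀ N ⊆ S, (∀ y ∈ N, G.Adj v y) → N.card ≤ k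

/-- A `(1,2,2,2)`-packing coloring of the subgraph induced on `S`, the color `0` being the one that
only has to be independent, such that no path on four vertices, none of which has color `0`,
has inner vertices of degree two. -/
structure Good (G : SimpleGraph V) (S : Finset V) (c : V → Fin 4) : Prop where
  proper : ∀ x ∈ S, ∀ y ∈ S, G.Adj x y → c x ≠ c y
  square : ∀ x ∈ S, ∀ y ∈ S, ∀ z ∈ S, G.Adj x y → G.Adj y z → x ≠ z → c x = c z → c x = 0
  path : ∀ p ∈ S, ∀ w ∈ S, ∀ w' ∈ S, ∀ q ∈ S, G.Adj p w → G.Adj w w' → G.Adj w' q → p ≠ w' →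
    w ≠ q → (∀ z ∈ S, G.Adj w z → z = p ∨ z = w') → (∀ z ∈ S, G.Adj w' z → z = w ∨ z = q) →
    c p = 0 ∨ c w = 0 ∨ c w' = 0 ∨ c q = 0

/-- The subgraph induced on `S` has a good coloring in which `v` does not have color `0`, but all
its neighbours have. -/
def Centered (G : SimpleGraph V) (S : Finset V) (v : V) : Prop :=
  ∃ c, G.Good S c ∧ c v ≠ 0 ∧ ∀ y ∈ S, G.Adj v y → c y = 0

/-- The subgraph induced on `S` has a good coloring in which `u` and `v` do not have color `0`, but
all neighbours of `v` other than `u` have. -/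
def Paired (G : SimpleGraph V) (S : Finset V) (u v : V) : Prop :=
  ∃ c, G.Good S c ∧ c u ≠ 0 ∧ c v ≠ 0 ∧ ∀ y ∈ S, G.Adj v y → y ≠ u → c y = 0

/-- The good coloring `c` of `A` extends to one of `S` so that the vertices whose neighbours all
have color `0` keep this property. -/
def Extendable (G : SimpleGraph V) (A S : Finset V) (c : V → Fin 4) : Prop :=
  ∃ c', G.Good S c' ∧ (∀ a ∈ A, c' a = c a) ∧
    ∀ a ∈ A, c a ≠ 0 → (∀ b ∈ A, G.Adj a b → c b = 0) → ∀ d ∈ S, G.Adj a d → c' d = 0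

theorem Good.congr (h : G.Good S c) (hc : ∀ x ∈ S, c' x = c x) : G.Good S c' := by
  refine ⟨fun x hx y hy => ?_, fun x hx y hy z hz => ?_, fun p hp w hw w' hw' q hq => ?_⟩
  · rw [hc x hx, hc y hy]; exact h.proper x hx y hy
  · rw [hc x hx, hc z hz]; exact h.square x hx y hy z hz
  · rw [hc p hp, hc w hw, hc w' hw', hc q hq]; exact h.path p hp w hw w' hw' q hq

/-- Renaming nonzero colors is how independently obtained colorings of two pieces are matched. -/
theorem Good.perm (h : G.Good S c) (σ : Equiv.Perm (Fin 4)) (hσ : σ 0 = 0) :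
    G.Good S (fun x => σ (c x)) := by
  have h0 : ∀ k, σ k = 0 ↔ k = 0 := fun k => by
    rw [← hσ]; exact σ.injective.eq_iff.trans (by rw [hσ])
  refine ⟨fun x hx y hy hxy e => h.proper x hx y hy hxy (σ.injective e),
    fun x hx y hy z hz hxy hyz hne e => ?_, fun p hp w hw w' hw' q hq => ?_⟩
  · exact (h0 _).2 (h.square x hx y hy z hz hxy hyz hne (σ.injective e))
  · simp only [h0]; exact h.path p hp w hw w' hw' q hq

theorem exists_perm_fin_four {k l : Fin 4} (hk : k ≠ 0) (hl : l ≠ 0) :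
    ∃ σ : Equiv.Perm (Fin 4), σ 0 = 0 ∧ σ k = l :=
  ⟨Equiv.swap k l, Equiv.swap_apply_of_ne_of_ne hk.symm hl.symm, Equiv.swap_apply_left _ _⟩

theorem exists_perm_fin_four_pair {k l k' l' : Fin 4} (hk : k ≠ 0) (hl : l ≠ 0) (hkl : k ≠ l)
    (hk' : k' ≠ 0) (hl' : l' ≠ 0) (hkl' : k' ≠ l') :
    ∃ σ : Equiv.Perm (Fin 4), σ 0 = 0 ∧ σ k = k' ∧ σ l = l' := by
  have h1 : Equiv.swap k k' l ≠ k' := fun e => hkl (by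
    exact ((Equiv.swap k k').injective (e.trans (Equiv.swap_apply_left k k').symm)).symm)
  have h2 : Equiv.swap k k' 0 = 0 := Equiv.swap_apply_of_ne_of_ne hk.symm hk'.symm
  have h3 : Equiv.swap k k' l ≠ 0 := fun e => hl (by
    exact (Equiv.swap k k').injective (e.trans h2.symm))
  refine ⟨(Equiv.swap k k').trans (Equiv.swap (Equiv.swap k k' l) l'), ?_, ?_, ?_⟩
  · simp only [Equiv.trans_apply, h2]
    exact Equiv.swap_apply_of_ne_of_ne h3.symm hl'.symm
  · simp only [Equiv.trans_apply, Equiv.swap_apply_left]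
    exact Equiv.swap_apply_of_ne_of_ne h1.symm hkl'
  · simp

/-- There is a nonzero color not used on a set of at most two vertices. -/
theorem exists_color_not_mem (c : V → Fin 4) (N : Finset V) (hN : N.card ≤ 2) :
    ∃ k : Fin 4, k ≠ 0 ∧ ∀ y ∈ N, c y ≠ k := by
  by_contra! h
  have hsub : ({1, 2, 3} : Finset (Fin 4)) ⊆ N.image c := fun k hk => by
    obtain ⟨y, hy, e⟩ := h k (by fin_cases hk <;> decide)
    exact Finset.mem_image.2 ⟨y, hy, e⟩
  have := (Finset.card_le_card hsub).trans Finset.card_image_le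
  have h3 : ({1, 2, 3} : Finset (Fin 4)).card = 3 := by decide
  omega

theorem exists_color_avoiding (c : V → Fin 4) {v : V} (hd : G.DegreeLE A 2 v) :
    ∃ k : Fin 4, k ≠ 0 ∧ ∀ y ∈ A, G.Adj v y → c y ≠ k := by
  classical
  obtain ⟨k, hk, h⟩ := exists_color_not_mem c (A.filter (G.Adj v))
    (hd _ (Finset.filter_subset _ _) fun y hy => (Finset.mem_filter.1 hy).2)
  exact ⟨k, hk, fun y hy hv => h y (Finset.mem_filter.2 ⟨hy, hv⟩)⟩

theorem DegreeLE.mono {k : ℕ} {v : V} (h : G.DegreeLE S k v) (hA : A ⊆ S) : G.DegreeLE A k v :=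
  fun N hN => h N (hN.trans hA)

theorem DegreeLE.pred {k : ℕ} {v x : V} (h : G.DegreeLE S (k + 1) v) (hA : A ⊆ S) (hx : x ∈ S)
    (hxA : x ∉ A) (hvx : G.Adj v x) : G.DegreeLE A k v := by
  classical
  intro N hN hadj
  have := h (insert x N) (Finset.insert_subset hx (hN.trans hA)) (fun y hy => by
    rcases Finset.mem_insert.1 hy with rfl | hy
    exacts [hvx, hadj y hy])
  rw [Finset.card_insert_of_notMem fun h => hxA (hN h)] at this
  omega

variable [DecidableEq V]

/-- By `hedge`, a path with two edges passes from one piece to the other only at a common vertex;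
`hcross` handles these paths. -/
theorem Good.glue (hA : G.Good A c) (hB : G.Good B c)
    (hedge : ∀ x ∈ A ∪ B, ∀ y ∈ A ∪ B, G.Adj x y → (x ∈ A ∧ y ∈ A) ∨ (x ∈ B ∧ y ∈ B))
    (hcross : ∀ p ∈ A, ∀ y ∈ A, y ∈ B → ∀ q ∈ B, p ∉ B → q ∉ A → G.Adj y p → G.Adj y q →
      c p = c q → c p = 0)
    (hpath : ∀ p ∈ A ∪ B, ∀ w ∈ A ∪ B, ∀ w' ∈ A ∪ B, ∀ q ∈ A ∪ B, G.Adj p w → G.Adj w w' →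
      G.Adj w' q → p ≠ w' → w ≠ q → (∀ z ∈ A ∪ B, G.Adj w z → z = p ∨ z = w') →
      (∀ z ∈ A ∪ B, G.Adj w' z → z = w ∨ z = q) →
      (p ∈ A ∧ w ∈ A ∧ w' ∈ A ∧ q ∈ A) ∨ (p ∈ B ∧ w ∈ B ∧ w' ∈ B ∧ q ∈ B)) :
    G.Good (A ∪ B) c := by
  refine ⟨fun x hx y hy hxy => ?_, fun x hx y hy z hz hxy hyz hne e => ?_,
    fun p hp w hw w' hw' q hq h1 h2 h3 h4 h5 h6 h7 => ?_⟩
  · rcases hedge x hx y hy hxy with h | h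
    · exact hA.proper x h.1 y h.2 hxy
    · exact hB.proper x h.1 y h.2 hxy
  · rcases hedge x hx y hy hxy with h | h <;> rcases hedge y hy z hz hyz with h' | h'
    · exact hA.square x h.1 y h.2 z h'.2 hxy hyz hne e
    · by_cases hxB : x ∈ B
      · exact hB.square x hxB y h'.1 z h'.2 hxy hyz hne e
      by_cases hzA : z ∈ A
      · exact hA.square x h.1 y h.2 z hzA hxy hyz hne e
      exact hcross x h.1 y h.2 h'.1 z h'.2 hxB hzA hxy.symm hyz e
    · by_cases hxA : x ∈ A
      · exact hA.square x hxA y h'.1 z h'.2 hxy hyz hne e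
      by_cases hzB : z ∈ B
      · exact hB.square x h.1 y h.2 z hzB hxy hyz hne e
      rw [e]
      exact hcross z h'.2 y h'.1 h.2 x h.1 hzB hxA hyz hxy.symm e.symm
    · exact hB.square x h.1 y h.2 z h'.2 hxy hyz hne e
  · rcases hpath p hp w hw w' hw' q hq h1 h2 h3 h4 h5 h6 h7 with h | h
    · exact hA.path p h.1 w h.2.1 w' h.2.2.1 q h.2.2.2 h1 h2 h3 h4 h5
        (fun z hz => h6 z (Finset.mem_union_left _ hz)) (fun z hz => h7 z (Finset.mem_union_left _ hz))
    · exact hB.path p h.1 w h.2.1 w' h.2.2.1 q h.2.2.2 h1 h2 h3 h4 h5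
        (fun z hz => h6 z (Finset.mem_union_right _ hz))
        (fun z hz => h7 z (Finset.mem_union_right _ hz))

/-- `hz` secures the path clause: a path on four vertices using the bridge contains both of its ends
and a further neighbor of one of them. -/
theorem Good.union_of_bridge (hA : G.Good A c) (hD : G.Good D c) (hdisj : Disjoint A D) {w x : V}
    (hw : w ∈ A) (hx : x ∈ D)
    (hedge : ∀ a ∈ A, ∀ d ∈ D, G.Adj a d → a = w ∧ d = x) (hwx : c w ≠ c x)
    (hcw : ∀ p ∈ A, G.Adj w p → c p = c x → c p = 0)
    (hcx : ∀ q ∈ D, G.Adj x q → c q = c w → c q = 0)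
    (hz : c w = 0 ∨ c x = 0 ∨
      (∀ p ∈ A, G.Adj w p → c p = 0) ∧ (∀ q ∈ D, G.Adj x q → c q = 0)) :
    G.Good (A ∪ D) c := by
  have hAD : ∀ y, y ∈ A → y ∈ D → False := fun y h1 h2 => Finset.disjoint_left.1 hdisj h1 h2
  have hedge' : ∀ d ∈ D, ∀ a ∈ A, G.Adj d a → a = w ∧ d = x := fun d hd a ha h =>
    hedge a ha d hd h.symm
  refine ⟨fun a ha b hb hab => ?_, fun a ha y hy z hz' hay hyz hne e => ?_,
    fun p hp y hy y' hy' q hq h1 h2 h3 h4 h5 h6 h7 => ?_⟩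
  · rcases Finset.mem_union.1 ha with ha | ha <;> rcases Finset.mem_union.1 hb with hb | hb
    · exact hA.proper a ha b hb hab
    · obtain ⟨rfl, rfl⟩ := hedge a ha b hb hab; exact hwx
    · obtain ⟨rfl, rfl⟩ := hedge' a ha b hb hab; exact hwx.symm
    · exact hD.proper a ha b hb hab
  · rcases Finset.mem_union.1 ha with ha | ha <;> rcases Finset.mem_union.1 hy with hy | hy <;>
      rcases Finset.mem_union.1 hz' with hz' | hz'
    · exact hA.square a ha y hy z hz' hay hyz hne e
    · obtain ⟨rfl, rfl⟩ := hedge y hy z hz' hyz; exact hcw a ha hay.symm e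
    · obtain ⟨rfl, rfl⟩ := hedge a ha y hy hay
      exact absurd (hedge' _ hy z hz' hyz).1.symm hne
    · obtain ⟨rfl, rfl⟩ := hedge a ha y hy hay
      rw [e]; exact hcx z hz' hyz e.symm
    · obtain ⟨rfl, rfl⟩ := hedge' a ha y hy hay
      rw [e]; exact hcw z hz' hyz e.symm
    · obtain ⟨rfl, rfl⟩ := hedge' a ha y hy hay
      exact absurd (hedge _ hy z hz' hyz).2.symm hne
    · obtain ⟨rfl, rfl⟩ := hedge' y hy z hz' hyz; exact hcx a ha hay.symm e
    · exact hD.square a ha y hy z hz' hay hyz hne e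
  · have mA : ∀ {z}, z ∈ A → z ∈ A ∪ D := fun h => Finset.mem_union_left _ h
    have mD : ∀ {z}, z ∈ D → z ∈ A ∪ D := fun h => Finset.mem_union_right _ h
    rcases Finset.mem_union.1 hp with hp | hp <;> rcases Finset.mem_union.1 hy with hy | hy <;>
      rcases Finset.mem_union.1 hy' with hy' | hy' <;> rcases Finset.mem_union.1 hq with hq | hq
    all_goals first
      | exact hA.path p hp y hy y' hy' q hq h1 h2 h3 h4 h5 (fun z hz => h6 z (mA hz))
          (fun z hz => h7 z (mA hz))
      | exact hD.path p hp y hy y' hy' q hq h1 h2 h3 h4 h5 (fun z hz => h6 z (mD hz))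
          (fun z hz => h7 z (mD hz))
      | grind only [adj_comm]

end SimpleGraph

/-! ### Extending a coloring across a bridge or along an edge. -/

namespace SimpleGraph

variable {V : Type*} {G : SimpleGraph V} {S A B D : Finset V} {c c' : V → Fin 4}

theorem DegreeLE.eq_or_eq [DecidableEq V] {v a b : V} (h : G.DegreeLE A 2 v) (ha : a ∈ A)
    (hb : b ∈ A) (hab : a ≠ b) (hva : G.Adj v a) (hvb : G.Adj v b) {z : V} (hz : z ∈ A)
    (hvz : G.Adj v z) : z = a ∨ z = b := by
  by_contra! hne
  have := h {z, a, b} (by simp [Finset.insert_subset_iff, ha, hb, hz])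
    (by simp [hva, hvb, hvz])
  rw [Finset.card_eq_three.2 ⟨z, a, b, hne.1, hne.2, hab, rfl⟩] at this
  omega

variable {w w' x x' : V}

/-- `D` is attached to `A` along the edge `ww'` by the edges `wx` and `w'x'`. -/
structure AttachedAt (G : SimpleGraph V) (A D : Finset V) (w w' x x' : V) : Prop where
  disjoint : Disjoint A D
  left_mem : w ∈ A
  right_mem : w' ∈ A
  left_mem' : x ∈ D
  right_mem' : x' ∈ D
  adj : G.Adj w w'
  adj_left : G.Adj w x
  adj_right : G.Adj w' x'
  eq_or_eq : ∀ a ∈ A, ∀ d ∈ D, G.Adj a d → (a = w ∧ d = x) ∨ (a = w' ∧ d = x')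

theorem AttachedAt.swap (h : G.AttachedAt A D w w' x x') : G.AttachedAt A D w' w x' x :=
  ⟨h.disjoint, h.right_mem, h.left_mem, h.right_mem', h.left_mem', h.adj.symm, h.adj_right,
    h.adj_left, fun a ha d hd had => (h.eq_or_eq a ha d hd had).symm⟩

variable [DecidableEq V]

theorem Good.update_isolated (h : G.Good S c) {x : V} (hx : ∀ y ∈ S, ¬ G.Adj x y) (k : Fin 4) :
    G.Good S (Function.update c x k) := by
  have key : ∀ a b, G.Adj a b → a ∈ S → b ∈ S →
      Function.update c x k a = c a ∧ Function.update c x k b = c b := by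
    intro a b hab ha hb
    constructor <;> apply Function.update_of_ne
    · rintro rfl; exact hx b hb hab
    · rintro rfl; exact hx a ha hab.symm
  refine ⟨fun a ha b hb hab => ?_, fun a ha y hy z hz hay hyz => ?_,
    fun p hp w hw w' hw' q hq hpw hww' hwq => ?_⟩
  · rw [(key a b hab ha hb).1, (key a b hab ha hb).2]; exact h.proper a ha b hb hab
  · rw [(key a y hay ha hy).1, (key y z hyz hy hz).2]; exact h.square a ha y hy z hz hay hyz
  · rw [(key p w hpw hp hw).1, (key w w' hww' hw hw').1, (key w w' hww' hw hw').2,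
      (key w' q hwq hw' hq).2]
    exact h.path p hp w hw w' hw' q hq hpw hww' hwq

theorem Good.union_of_not_adj (hA : G.Good A c) (hD : G.Good D c) (hdisj : Disjoint A D)
    (hedge : ∀ a ∈ A, ∀ d ∈ D, ¬ G.Adj a d) : G.Good (A ∪ D) c := by
  have hAD : ∀ y, y ∈ A → y ∈ D → False := fun y h1 h2 => Finset.disjoint_left.1 hdisj h1 h2
  have h2 : ∀ x ∈ A ∪ D, ∀ y ∈ A ∪ D, G.Adj x y → (x ∈ A ∧ y ∈ A) ∨ (x ∈ D ∧ y ∈ D) := by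
    intro x hx y hy hxy
    rcases Finset.mem_union.1 hx with hx | hx <;> rcases Finset.mem_union.1 hy with hy | hy
    · exact .inl ⟨hx, hy⟩
    · exact absurd hxy (hedge x hx y hy)
    · exact absurd hxy.symm (hedge y hy x hx)
    · exact .inr ⟨hx, hy⟩
  refine hA.glue hD h2 (fun p _ y hy hy' => (hAD y hy hy').elim) ?_
  intro p hp w hw w' hw' q hq h1 h3 h4 _ _ _ _
  have a1 := h2 p hp w hw h1
  have a2 := h2 w hw w' hw' h3
  have a3 := h2 w' hw' q hq h4
  have b1 := hAD w
  have b2 := hAD w'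
  tauto

theorem extendable_of_not_adj (hA : G.Good A c) (hD : G.Good D c') (hdisj : Disjoint A D)
    (hedge : ∀ a ∈ A, ∀ d ∈ D, ¬ G.Adj a d) : G.Extendable A (A ∪ D) c := by
  have hAD : ∀ y, y ∈ A → y ∉ D := fun y h1 h2 => Finset.disjoint_left.1 hdisj h1 h2
  have e : ∀ a ∈ A, (if a ∈ D then c' a else c a) = c a := fun a ha => if_neg (hAD a ha)
  refine ⟨fun y => if y ∈ D then c' y else c y, ?_, e, fun a ha _ hz d hd had => ?_⟩
  · exact (hA.congr e).union_of_not_adj (hD.congr fun d hd => if_pos hd) hdisj hedge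
  · rcases Finset.mem_union.1 hd with hd | hd
    · exact (e d hd).trans (hz d hd had)
    · exact absurd had (hedge a ha d hd)

/-- Gluing along a bridge, for colorings of the two sides that need not agree. -/
theorem extendable_of_bridge (hA : G.Good A c) (hdisj : Disjoint A D) {w x : V}
    (hw : w ∈ A) (hx : x ∈ D) (hwx : G.Adj w x)
    (hedge : ∀ a ∈ A, ∀ d ∈ D, G.Adj a d → a = w ∧ d = x)
    (hdw : G.DegreeLE (A ∪ D) 3 w) (hdx : G.DegreeLE (A ∪ D) 3 x)
    (hD : ∀ v ∈ D, G.Centered D v) : G.Extendable A (A ∪ D) c := by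
  have hAD : ∀ y, y ∈ A → y ∉ D := fun y h1 h2 => Finset.disjoint_left.1 hdisj h1 h2
  have key : ∀ c', G.Good D c' → c w ≠ c' x → (∀ p ∈ A, G.Adj w p → c p = c' x → c p = 0) →
      (∀ q ∈ D, G.Adj x q → c' q = c w → c' q = 0) → (c w = 0 ∨ c' x = 0) →
      G.Extendable A (A ∪ D) c := by
    intro c' hc' hne hp hq hz
    have e : ∀ a ∈ A, (if a ∈ D then c' a else c a) = c a := fun a ha => if_neg (hAD a ha)
    have e' : ∀ a ∈ D, (if a ∈ D then c' a else c a) = c' a := fun a ha => if_pos ha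
    refine ⟨fun y => if y ∈ D then c' y else c y, ?_, e, fun a ha haz hz' d hd had => ?_⟩
    · refine (hA.congr e).union_of_bridge (hc'.congr e') hdisj hw hx hedge ?_ ?_ ?_ ?_
      · rw [e w hw, e' x hx]; exact hne
      · intro p hpA hwp; rw [e p hpA, e' x hx]; exact hp p hpA hwp
      · intro q hqD hxq; rw [e' q hqD, e w hw]; exact hq q hqD hxq
      · rw [e w hw, e' x hx]; tauto
    · rcases Finset.mem_union.1 hd with hd | hd
      · exact (e d hd).trans (hz' d hd had)
      · obtain ⟨rfl, rfl⟩ := hedge a ha d hd had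
        exact (e' d hd).trans (hz.resolve_left haz)
  by_cases hcw : c w = 0
  -- The bridge uses up one of three neighbors of `w`, so a nonzero color is free around `w` in `A`;
  -- it goes to `x`, the center of `D`.
  · obtain ⟨k, hk, hkA⟩ := exists_color_avoiding c
      (hdw.pred Finset.subset_union_left (Finset.mem_union_right _ hx) (fun h => hAD x h hx) hwx)
    obtain ⟨c', hc', hx0, hxn⟩ := hD x hx
    obtain ⟨σ, hσ0, hσ⟩ := exists_perm_fin_four hx0 hk
    refine key _ (hc'.perm σ hσ0) ?_ ?_ ?_ (.inl hcw)
    · rw [hσ, hcw]; exact hk.symm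
    · intro p hp hwp e; rw [hσ] at e; exact absurd e (hkA p hp hwp)
    · intro q hq hxq _; rw [hxn q hq hxq, hσ0]
  · obtain ⟨c', hc', hx0⟩ : ∃ c', G.Good D c' ∧ c' x = 0 := by
      -- Centering at a neighbor of `x` gives `x` color 0; an isolated `x` may simply be recolored.
      by_cases hy : ∃ y ∈ D, G.Adj x y
      · obtain ⟨y, hy, hxy⟩ := hy
        obtain ⟨c', hc', -, hyn⟩ := hD y hy
        exact ⟨c', hc', hyn x hx hxy.symm⟩
      · push Not at hy
        obtain ⟨c', hc', -⟩ := hD x hx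
        exact ⟨_, hc'.update_isolated hy 0, by simp⟩
    obtain ⟨k, hk, hkD⟩ := exists_color_avoiding c'
      (hdx.pred Finset.subset_union_right (Finset.mem_union_left _ hw) (hAD w hw) hwx.symm)
    obtain ⟨σ, hσ0, hσ⟩ := exists_perm_fin_four hk hcw
    refine key _ (hc'.perm σ hσ0) ?_ ?_ ?_ (.inr ?_)
    · rw [hx0, hσ0]; exact hcw
    · intro p _ _ e; rw [e, hx0, hσ0]
    · intro q hq hxq e; rw [← hσ] at e; exact absurd (σ.injective e) (hkD q hq hxq)
    · rw [hx0, hσ0]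

/-- Both sides are centered at the ends of the bridge, and the two centers are renamed apart; all
their other neighbors have color 0. -/
theorem paired_of_bridge (hdisj : Disjoint A D) {u v : V} (hu : u ∈ A) (hv : v ∈ D)
    (hedge : ∀ a ∈ A, ∀ d ∈ D, G.Adj a d → a = u ∧ d = v)
    (hA : G.Centered A u) (hD : G.Centered D v) : G.Paired (A ∪ D) u v := by
  have hAD : ∀ y, y ∈ A → y ∉ D := fun y h1 h2 => Finset.disjoint_left.1 hdisj h1 h2
  obtain ⟨c, hc, hcu, hcn⟩ := hA
  obtain ⟨c', hc', hcv, hcn'⟩ := hD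
  obtain ⟨k, hk, hku⟩ : ∃ k : Fin 4, k ≠ 0 ∧ c u ≠ k := by
    generalize c u = l; revert l; decide
  obtain ⟨σ, hσ0, hσ⟩ := exists_perm_fin_four hcv hk
  have e : ∀ a ∈ A, (if a ∈ D then σ (c' a) else c a) = c a := fun a ha => if_neg (hAD a ha)
  have e' : ∀ a ∈ D, (if a ∈ D then σ (c' a) else c a) = σ (c' a) := fun a ha => if_pos ha
  refine ⟨fun y => if y ∈ D then σ (c' y) else c y, ?_, ?_, ?_, ?_⟩
  · refine (hc.congr e).union_of_bridge ((hc'.perm σ hσ0).congr e') hdisj hu hv hedge ?_ ?_ ?_ ?_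
    · rw [e u hu, e' v hv, hσ]; exact hku
    · intro p hp hup _; rw [e p hp]; exact hcn p hp hup
    · intro q hq hvq _; rw [e' q hq, hcn' q hq hvq, hσ0]
    · refine .inr (.inr ⟨fun p hp hup => ?_, fun q hq hvq => ?_⟩)
      · rw [e p hp]; exact hcn p hp hup
      · rw [e' q hq, hcn' q hq hvq, hσ0]
  · simp only [e u hu]; exact hcu
  · exact ne_of_eq_of_ne ((e' v hv).trans hσ) hk
  · intro y hy hvy hyu
    rcases Finset.mem_union.1 hy with hy | hy
    · exact absurd (hedge y hy v hv hvy.symm).1 hyu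
    · exact (e' y hy).trans (by rw [hcn' y hy hvy, hσ0])

theorem AttachedAt.mem_of_adj (h : G.AttachedAt A D w w' x x') {d z : V} (hd : d ∈ D)
    (hz : z ∈ A ∪ D) (hdz : G.Adj d z) : z ∈ insert w (insert w' D) := by
  simp only [Finset.mem_insert]
  rcases Finset.mem_union.1 hz with hz | hz
  · rcases h.eq_or_eq z hz d hd hdz.symm with h | h
    · exact .inl h.1
    · exact .inr (.inl h.1)
  · exact .inr (.inr hz)

theorem AttachedAt.mem_of_adj' (h : G.AttachedAt A D w w' x x') {a z : V} (ha : a ∈ A)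
    (haw : a ≠ w) (haw' : a ≠ w') (hz : z ∈ A ∪ D) (haz : G.Adj a z) : z ∈ A := by
  rcases Finset.mem_union.1 hz with hz | hz
  · exact hz
  · rcases h.eq_or_eq a ha z hz haz with h | h
    · exact absurd h.1 haw
    · exact absurd h.1 haw'

/-- Since `w` already has the neighbors `w'` and `x`, a path with `w` as inner vertex of degree two
runs through both. -/
theorem AttachedAt.path_mem (h : G.AttachedAt A D w w' x x') {p y q : V}
    (hq : q ∈ A ∪ D) (hyq : G.Adj y q)
    (hw : ∀ z ∈ A ∪ D, G.Adj w z → z = p ∨ z = y) (hy : ∀ z ∈ A ∪ D, G.Adj y z → z = w ∨ z = q) :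
    p ∈ insert w (insert w' D) ∧ y ∈ insert w (insert w' D) ∧ q ∈ insert w (insert w' D) := by
  have hAD : ∀ y, y ∈ A → y ∉ D := fun y h1 h2 => Finset.disjoint_left.1 h.disjoint h1 h2
  have m : ∀ {z}, z ∈ D → z ∈ insert w (insert w' D) := fun hz => by simp [hz]
  rcases hw w' (Finset.mem_union_left _ h.right_mem) h.adj with rfl | rfl <;>
    rcases hw x (Finset.mem_union_right _ h.left_mem') h.adj_left with rfl | rfl
  · exact absurd h.left_mem' (hAD _ h.right_mem)
  · exact ⟨by simp, m h.left_mem', h.mem_of_adj h.left_mem' hq hyq⟩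
  · refine ⟨m h.left_mem', by simp, ?_⟩
    rcases hy x' (Finset.mem_union_right _ h.right_mem') h.adj_right with rfl | rfl
    · exact absurd h.right_mem' (hAD _ h.left_mem)
    · exact m h.right_mem'
  · exact absurd h.left_mem' (hAD _ h.right_mem)

/-- The two pieces overlap in `w`, `w'`, so the new pairs at distance two consist of `x` and a
neighbor of `w` in `A`, or of `x'` and a neighbor of `w'` in `A`. -/
theorem AttachedAt.good_union (h : G.AttachedAt A D w w' x x') (hA : G.Good A c)
    (hH : G.Good (insert w (insert w' D)) c)
    (hcw : ∀ p ∈ A, G.Adj w p → c p = c x → c p = 0)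
    (hcw' : ∀ p ∈ A, G.Adj w' p → c p = c x' → c p = 0) : G.Good (A ∪ D) c := by
  have hU : A ∪ insert w (insert w' D) = A ∪ D := by
    rw [Finset.union_insert, Finset.union_insert, Finset.insert_eq_of_mem, Finset.insert_eq_of_mem]
    · exact Finset.mem_union_left _ h.right_mem
    · exact Finset.mem_insert_of_mem (Finset.mem_union_left _ h.left_mem)
  have hcomm : insert w (insert w' D) = insert w' (insert w D) := Finset.insert_comm _ _ _
  have m : ∀ {z}, z ∈ D → z ∈ insert w (insert w' D) := fun hz => by simp [hz]
  rw [← hU]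
  refine hA.glue hH ?_ ?_ ?_
  · rw [hU]
    intro a ha b hb hab
    by_cases haD : a ∈ D
    · exact .inr ⟨m haD, h.mem_of_adj haD hb hab⟩
    by_cases hbD : b ∈ D
    · exact .inr ⟨h.mem_of_adj hbD ha hab.symm, m hbD⟩
    exact .inl ⟨(Finset.mem_union.1 ha).resolve_right haD, (Finset.mem_union.1 hb).resolve_right hbD⟩
  · intro p hp y hy hyH q hq _ hqA hyp hyq e
    have hqD : q ∈ D := by
      simp only [Finset.mem_insert] at hq
      rcases hq with rfl | rfl | hq
      exacts [absurd h.left_mem hqA, absurd h.right_mem hqA, hq]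
    rcases h.eq_or_eq y hy q hqD hyq with ⟨rfl, rfl⟩ | ⟨rfl, rfl⟩
    · exact hcw p hp hyp e
    · exact hcw' p hp hyp e
  · rw [hU]
    intro p hp y hy y' hy' q hq hpy hyy' hyq _ _ h7 h8
    by_cases ey : y = w
    · subst ey
      obtain ⟨a1, a2, a3⟩ := h.path_mem hq hyq h7 h8
      exact .inr ⟨a1, by simp, a2, a3⟩
    by_cases ey' : y = w'
    · subst ey'
      obtain ⟨a1, a2, a3⟩ := h.swap.path_mem hq hyq h7 h8
      rw [hcomm]
      exact .inr ⟨a1, by simp, a2, a3⟩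
    have h7' : ∀ z ∈ A ∪ D, G.Adj y z → z = y' ∨ z = p := fun z hz hyz => (h7 z hz hyz).symm
    have h8' : ∀ z ∈ A ∪ D, G.Adj y' z → z = q ∨ z = y := fun z hz hyz => (h8 z hz hyz).symm
    by_cases fy : y' = w
    · subst fy
      obtain ⟨a1, a2, a3⟩ := h.path_mem hp hpy.symm h8' h7'
      exact .inr ⟨a3, a2, by simp, a1⟩
    by_cases fy' : y' = w'
    · subst fy'
      obtain ⟨a1, a2, a3⟩ := h.swap.path_mem hp hpy.symm h8' h7'
      rw [hcomm]
      exact .inr ⟨a3, a2, by simp, a1⟩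
    by_cases hyD : y ∈ D
    · have b := h.mem_of_adj hyD hy' hyy'
      have b' : y' ∈ D := by
        simp only [Finset.mem_insert] at b; tauto
      exact .inr ⟨h.mem_of_adj hyD hp hpy.symm, m hyD, b, h.mem_of_adj b' hq hyq⟩
    · have hyA : y ∈ A := (Finset.mem_union.1 hy).resolve_right hyD
      have b := h.mem_of_adj' hyA ey ey' hy' hyy'
      exact .inl ⟨h.mem_of_adj' hyA ey ey' hp hpy.symm, hyA, b, h.mem_of_adj' b fy fy' hq hyq⟩

end SimpleGraph

namespace SimpleGraph

variable {V : Type*} {G : SimpleGraph V} {S A B D : Finset V} {c c' : V → Fin 4} [DecidableEq V]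

variable {w w' x x' : V}

/-- `hzero` and `hzero'` protect centers: a nonzero `w` can be a center of `A` only if `w'` has
color 0, and then `x` must get 0 as well. -/
theorem AttachedAt.extendable_of_good (h : G.AttachedAt A D w w' x x') (hA : G.Good A c)
    (hH : G.Good (insert w (insert w' D)) c') (ew : c' w = c w) (ew' : c' w' = c w')
    (hcw : ∀ p ∈ A, G.Adj w p → c p = c' x → c p = 0)
    (hcw' : ∀ p ∈ A, G.Adj w' p → c p = c' x' → c p = 0)
    (hzero : c w = 0 ∨ c w' ≠ 0 ∨ c' x = 0) (hzero' : c w' = 0 ∨ c w ≠ 0 ∨ c' x' = 0) :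
    G.Extendable A (A ∪ D) c := by
  have hAD : ∀ y, y ∈ A → y ∉ D := fun y h1 h2 => Finset.disjoint_left.1 h.disjoint h1 h2
  have e : ∀ a ∈ A, (if a ∈ D then c' a else c a) = c a := fun a ha => if_neg (hAD a ha)
  have e' : ∀ a ∈ D, (if a ∈ D then c' a else c a) = c' a := fun a ha => if_pos ha
  refine ⟨fun y => if y ∈ D then c' y else c y, ?_, e, fun a ha haz hz d hd had => ?_⟩
  · refine h.good_union (hA.congr e) (hH.congr ?_) ?_ ?_
    · intro y hy
      simp only [Finset.mem_insert] at hy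
      rcases hy with rfl | rfl | hy
      · rw [e _ h.left_mem, ew]
      · rw [e _ h.right_mem, ew']
      · exact e' y hy
    · intro p hp hwp; rw [e p hp, e' x h.left_mem']; exact hcw p hp hwp
    · intro p hp hwp; rw [e p hp, e' x' h.right_mem']; exact hcw' p hp hwp
  · rcases Finset.mem_union.1 hd with hd | hd
    · exact (e d hd).trans (hz d hd had)
    · refine (e' d hd).trans ?_
      rcases h.eq_or_eq a ha d hd had with ⟨rfl, rfl⟩ | ⟨rfl, rfl⟩
      · have := hz w' h.right_mem h.adj; tauto
      · have := hz w h.left_mem h.adj.symm; tauto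

/-- Centering at `w'` puts 0 on `w` and `x'`, and makes `x` nonzero and different from `w'`. So `w'`
can be renamed to its given color and `x` to a color free around `w`. -/
theorem AttachedAt.extendable_of_zero (h : G.AttachedAt A D w w' x x') (hA : G.Good A c)
    (hdw : G.DegreeLE (A ∪ D) 3 w) (hC : G.Centered (insert w (insert w' D)) w')
    (hcw : c w = 0) : G.Extendable A (A ∪ D) c := by
  have hAD : ∀ y, y ∈ A → y ∉ D := fun y h1 h2 => Finset.disjoint_left.1 h.disjoint h1 h2
  obtain ⟨k, hk, hkA⟩ := exists_color_avoiding c (hdw.pred Finset.subset_union_left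
    (Finset.mem_union_right _ h.left_mem') (fun hx => hAD x hx h.left_mem') h.adj_left)
  obtain ⟨c', hc', hw'0, hn⟩ := hC
  have mw : w ∈ insert w (insert w' D) := Finset.mem_insert_self _ _
  have mw' : w' ∈ insert w (insert w' D) := by simp
  have mx : x ∈ insert w (insert w' D) := by simp [h.left_mem']
  have mx' : x' ∈ insert w (insert w' D) := by simp [h.right_mem']
  have hw0 : c' w = 0 := hn w mw h.adj.symm
  have hx0 : c' x ≠ 0 := fun e => hc'.proper w mw x mx h.adj_left (hw0.trans e.symm)
  have hxw' : c' w' ≠ c' x := fun e => hw'0 (hc'.square w' mw' w mw x mx h.adj.symm h.adj_left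
    (fun e => hAD _ h.right_mem (e ▸ h.left_mem')) e)
  have hcw' : c w' ≠ 0 := fun e => hA.proper w h.left_mem w' h.right_mem h.adj (hcw.trans e.symm)
  obtain ⟨σ, hσ0, hσ, hσ'⟩ := exists_perm_fin_four_pair hw'0 hx0 hxw' hcw' hk
    (hkA w' h.right_mem h.adj)
  have hx'0 : σ (c' x') = 0 := by rw [hn x' mx' h.adj_right, hσ0]
  refine h.extendable_of_good hA (hc'.perm σ hσ0) (by rw [hw0, hσ0, hcw]) hσ ?_ ?_
    (.inl hcw) (.inr (.inr hx'0))
  · intro p hp hwp e; rw [hσ'] at e; exact absurd e (hkA p hp hwp)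
  · intro p hp hwp e; rw [e, hx'0]

/-- `Paired` puts 0 on `x`. A nonzero `x'` differs from `w`, which is at distance two, and by `hq`
the other neighbors of `w'` in `A` have color 0. -/
theorem AttachedAt.extendable_of_ne_zero (h : G.AttachedAt A D w w' x x') (hA : G.Good A c)
    (hP : G.Paired (insert w (insert w' D)) w' w) (hcw : c w ≠ 0) (hcw' : c w' ≠ 0)
    (hq : ∀ q ∈ A, G.Adj w' q → q ≠ w → c q = 0) : G.Extendable A (A ∪ D) c := by
  have hAD : ∀ y, y ∈ A → y ∉ D := fun y h1 h2 => Finset.disjoint_left.1 h.disjoint h1 h2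
  obtain ⟨c', hc', hw'0, hw0, hn⟩ := hP
  have mw : w ∈ insert w (insert w' D) := Finset.mem_insert_self _ _
  have mw' : w' ∈ insert w (insert w' D) := by simp
  have mx : x ∈ insert w (insert w' D) := by simp [h.left_mem']
  have mx' : x' ∈ insert w (insert w' D) := by simp [h.right_mem']
  obtain ⟨σ, hσ0, hσ, hσ'⟩ := exists_perm_fin_four_pair hw0 hw'0
    (hc'.proper w mw w' mw' h.adj) hcw hcw' (hA.proper w h.left_mem w' h.right_mem h.adj)
  have hx0 : σ (c' x) = 0 := by
    rw [hn x mx h.adj_left (fun e => hAD _ h.right_mem (e ▸ h.left_mem')), hσ0]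
  refine h.extendable_of_good hA (hc'.perm σ hσ0) hσ hσ' ?_ ?_ (.inr (.inl hcw')) (.inr (.inl hcw))
  · intro p hp hwp e; rw [e, hx0]
  · intro p hp hwp e
    by_cases hpw : p = w
    · subst hpw
      refine absurd (σ.injective (hσ.trans e)) fun e' => hw0 ?_
      exact hc'.square p mw w' mw' x' mx' h.adj h.adj_right
        (fun e => hAD _ h.left_mem (e ▸ h.right_mem')) e'
    · exact hq p hp hwp hpw

theorem AttachedAt.extendable (h : G.AttachedAt A D w w' x x') (hA : G.Good A c)
    (hdw : G.DegreeLE (A ∪ D) 3 w) (hdw' : G.DegreeLE (A ∪ D) 3 w')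
    (hC : ∀ v ∈ insert w (insert w' D), G.Centered (insert w (insert w' D)) v)
    (hP : G.Paired (insert w (insert w' D)) w w') (hP' : G.Paired (insert w (insert w' D)) w' w) :
    G.Extendable A (A ∪ D) c := by
  have hAD : ∀ y, y ∈ A → y ∉ D := fun y h1 h2 => Finset.disjoint_left.1 h.disjoint h1 h2
  have hcomm : insert w (insert w' D) = insert w' (insert w D) := Finset.insert_comm _ _ _
  by_cases hcw : c w = 0
  · exact h.extendable_of_zero hA hdw (hC _ (by simp)) hcw
  by_cases hcw' : c w' = 0
  · exact h.swap.extendable_of_zero hA hdw' (hcomm ▸ hC _ (by simp)) hcw'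
  by_cases hq : ∀ q ∈ A, G.Adj w' q → q ≠ w → c q = 0
  · exact h.extendable_of_ne_zero hA hP' hcw hcw' hq
  -- With a nonzero `q` beyond `w'`, the roles are exchanged. A nonzero `p` beyond `w` would then
  -- violate the path clause on `p`, `w`, `w'`, `q`, because `w` and `w'` have degree two in `A`.
  refine h.swap.extendable_of_ne_zero hA (hcomm ▸ hP) hcw' hcw fun p hp hwp hpw' => ?_
  push Not at hq
  obtain ⟨q, hq, hwq, hqw, hq0⟩ := hq
  have h2 : G.DegreeLE A 2 w := hdw.pred Finset.subset_union_left
    (Finset.mem_union_right _ h.left_mem') (fun hx => hAD x hx h.left_mem') h.adj_left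
  have h2' : G.DegreeLE A 2 w' := hdw'.pred Finset.subset_union_left
    (Finset.mem_union_right _ h.right_mem') (fun hx => hAD x' hx h.right_mem') h.adj_right
  have := hA.path p hp w h.left_mem w' h.right_mem q hq hwp.symm h.adj hwq hpw' hqw.symm
    (fun z hz hwz => h2.eq_or_eq hp h.right_mem hpw' hwp h.adj hz hwz)
    (fun z hz hwz => h2'.eq_or_eq h.left_mem hq hqw.symm h.adj.symm hwq hz hwz)
  tauto

end SimpleGraph

/-! ### Colorings of chordless cycles. -/

namespace SimpleGraph

variable {V : Type*} {G : SimpleGraph V} {S A B D : Finset V} {c c' : V → Fin 4}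

/-- The successor of `i` on a cycle with vertices `0, …, n - 1`. -/
def cycleNext (n i : ℕ) : ℕ := if i + 1 = n then 0 else i + 1

theorem cycleNext_cases {n i : ℕ} (hi : i < n) :
    (i + 1 = n ∧ cycleNext n i = 0) ∨ (i + 1 < n ∧ cycleNext n i = i + 1) := by
  unfold cycleNext; split_ifs <;> omega

theorem cycleNext_lt {n i : ℕ} (hi : i < n) : cycleNext n i < n := by
  rcases cycleNext_cases hi with h | h <;> omega

theorem cycleNext_inj {n i j : ℕ} (hi : i < n) (hj : j < n) (h : cycleNext n i = cycleNext n j) :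
    i = j := by
  rcases cycleNext_cases hi with h1 | h1 <;> rcases cycleNext_cases hj with h2 | h2 <;> omega

/-- The vertices `p 0, …, p (n - 1)` form a chordless cycle of length at least four. -/
structure IsChordlessCycle (G : SimpleGraph V) (n : ℕ) (p : ℕ → V) : Prop where
  four_le : 4 ≤ n
  injOn : ∀ i < n, ∀ j < n, p i = p j → i = j
  adj_iff : ∀ i < n, ∀ j < n, G.Adj (p i) (p j) ↔ j = cycleNext n i ∨ i = cycleNext n j

variable [DecidableEq V] {n : ℕ} {p : ℕ → V}

theorem IsChordlessCycle.exists_good (h : G.IsChordlessCycle n p) (g : ℕ → Fin 4)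
    (h1 : ∀ i < n, g i ≠ g (cycleNext n i))
    (h2 : ∀ i < n, g i = g (cycleNext n (cycleNext n i)) → g i = 0)
    (h3 : ∀ i < n, g i = 0 ∨ g (cycleNext n i) = 0 ∨ g (cycleNext n (cycleNext n i)) = 0 ∨
      g (cycleNext n (cycleNext n (cycleNext n i))) = 0) :
    ∃ c, G.Good ((Finset.range n).image p) c ∧ ∀ i < n, c (p i) = g i := by
  classical
  obtain ⟨c, hc⟩ : ∃ c : V → Fin 4, ∀ i < n, c (p i) = g i := by
    refine ⟨fun x => if hx : ∃ i < n, p i = x then g hx.choose else 0, fun i hi => ?_⟩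
    have hx : ∃ j < n, p j = p i := ⟨i, hi, rfl⟩
    simp only [dif_pos hx]
    rw [h.injOn _ hx.choose_spec.1 i hi hx.choose_spec.2]
  refine ⟨c, ⟨?_, ?_, ?_⟩, hc⟩
  · intro x hx y hy
    simp only [Finset.mem_image, Finset.mem_range] at hx hy
    obtain ⟨i, hi, rfl⟩ := hx
    obtain ⟨j, hj, rfl⟩ := hy
    rw [h.adj_iff i hi j hj, hc i hi, hc j hj]
    rintro (rfl | rfl)
    exacts [h1 i hi, (h1 j hj).symm]
  · intro x hx y hy z hz
    simp only [Finset.mem_image, Finset.mem_range] at hx hy hz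
    obtain ⟨i, hi, rfl⟩ := hx
    obtain ⟨j, hj, rfl⟩ := hy
    obtain ⟨k, hk, rfl⟩ := hz
    rw [h.adj_iff i hi j hj, h.adj_iff j hj k hk, hc i hi, hc k hk]
    rintro (rfl | rfl) (rfl | e) hne
    · exact h2 i hi
    · exact absurd (congrArg p (cycleNext_inj hi hk e)) hne
    · exact absurd rfl hne
    · subst e
      intro e; rw [e]; exact h2 k hk e.symm
  · intro x hx y hy z hz w hw
    simp only [Finset.mem_image, Finset.mem_range] at hx hy hz hw
    obtain ⟨i, hi, rfl⟩ := hx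
    obtain ⟨j, hj, rfl⟩ := hy
    obtain ⟨k, hk, rfl⟩ := hz
    obtain ⟨l, hl, rfl⟩ := hw
    rw [h.adj_iff i hi j hj, h.adj_iff j hj k hk, h.adj_iff k hk l hl, hc i hi, hc j hj, hc k hk,
      hc l hl]
    intro a1 a2 a3 n1 n2 _ _
    rcases a1 with rfl | rfl
    · rcases a2 with rfl | e
      · rcases a3 with rfl | e
        · exact h3 i hi
        · exact absurd (congrArg p (cycleNext_inj hj hl e)) n2
      · exact absurd (congrArg p (cycleNext_inj hi hk e)) n1
    · rcases a2 with e | rfl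
      · exact absurd (congrArg p e.symm) n1
      · rcases a3 with e | rfl
        · exact absurd (congrArg p e.symm) n2
        · have := h3 l hl; tauto

theorem IsChordlessCycle.centered (h : G.IsChordlessCycle n p) :
    G.Centered ((Finset.range n).image p) (p 0) := by
  have hn := h.four_le
  -- The pattern 1 0 2 0 1 0 2 0 … ends with 3 0; the single 3 keeps the end of the alternation
  -- compatible with its start for every `n`.
  let g : ℕ → Fin 4 := fun i => if i + 2 = n then 3 else
    if i % 2 = 0 ∧ i + 1 ≠ n then (if i % 4 = 0 then 1 else 2) else 0
  obtain ⟨c, hc, hcg⟩ := h.exists_good g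
    (by
      intro i hi
      rcases cycleNext_cases hi with ⟨a, b⟩ | ⟨a, b⟩ <;> rw [b] <;> simp only [g] <;> grind)
    (by
      intro i hi
      rcases cycleNext_cases hi with ⟨a, b⟩ | ⟨a, b⟩ <;> rw [b] <;>
        rcases cycleNext_cases (b ▸ cycleNext_lt hi) with ⟨a', b'⟩ | ⟨a', b'⟩ <;> rw [b'] <;>
        simp only [g] <;> grind)
    (by
      intro i hi
      rcases cycleNext_cases hi with ⟨a, b⟩ | ⟨a, b⟩ <;> rw [b] <;>
        rcases cycleNext_cases (b ▸ cycleNext_lt hi) with ⟨a', b'⟩ | ⟨a', b'⟩ <;> rw [b'] <;>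
        simp only [g] <;> grind)
  refine ⟨c, hc, ?_, ?_⟩
  · rw [hcg 0 (by omega)]; simp only [g]; grind
  · intro y hy
    simp only [Finset.mem_image, Finset.mem_range] at hy
    obtain ⟨j, hj, rfl⟩ := hy
    rw [h.adj_iff 0 (by omega) j hj, hcg j hj]
    have h0 : cycleNext n 0 = 1 := by unfold cycleNext; grind
    rw [h0]
    rintro (rfl | e)
    · simp only [g]; grind
    · rcases cycleNext_cases hj with ⟨a, b⟩ | ⟨a, b⟩
      · simp only [g]; grind
      · omega

theorem IsChordlessCycle.paired (h : G.IsChordlessCycle n p) :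
    G.Paired ((Finset.range n).image p) (p (n - 1)) (p 0) := by
  have hn := h.four_le
  -- For odd `n` the alternation ends with 0 3. For even `n` it ends with 0 3 2, which with the 1 at
  -- `p 0` makes three nonzero colors in a row, still allowed by the path clause.
  let g : ℕ → Fin 4 := fun i =>
    if n % 2 = 1 then
      (if i + 1 = n then 3 else if i % 4 = 0 then 1 else if i % 2 = 0 then 2 else 0)
    else
      (if i + 1 = n then 2 else if i + 2 = n then 3 else if i % 4 = 0 then 1 else
        if i % 2 = 0 then 2 else 0)
  obtain ⟨c, hc, hcg⟩ := h.exists_good g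
    (by
      intro i hi
      rcases cycleNext_cases hi with ⟨a, b⟩ | ⟨a, b⟩ <;> rw [b] <;> simp only [g] <;> grind)
    (by
      intro i hi
      rcases cycleNext_cases hi with ⟨a, b⟩ | ⟨a, b⟩ <;> rw [b] <;>
        rcases cycleNext_cases (b ▸ cycleNext_lt hi) with ⟨a', b'⟩ | ⟨a', b'⟩ <;> rw [b'] <;>
        simp only [g] <;> grind)
    (by
      intro i hi
      rcases cycleNext_cases hi with ⟨a, b⟩ | ⟨a, b⟩ <;> rw [b] <;>
        rcases cycleNext_cases (b ▸ cycleNext_lt hi) with ⟨a', b'⟩ | ⟨a', b'⟩ <;> rw [b'] <;>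
        rcases cycleNext_cases (b' ▸ cycleNext_lt (b ▸ cycleNext_lt hi)) with ⟨a2, b2⟩ | ⟨a2, b2⟩ <;>
        rw [b2] <;> simp only [g] <;> grind)
  refine ⟨c, hc, ?_, ?_, ?_⟩
  · rw [hcg _ (by omega)]; simp only [g]; grind
  · rw [hcg 0 (by omega)]; simp only [g]; grind
  · intro y hy
    simp only [Finset.mem_image, Finset.mem_range] at hy
    obtain ⟨j, hj, rfl⟩ := hy
    rw [h.adj_iff 0 (by omega) j hj, hcg j hj]
    have h0 : cycleNext n 0 = 1 := by unfold cycleNext; grind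
    rw [h0]
    rintro (rfl | e) hne
    · simp only [g]; grind
    · rcases cycleNext_cases hj with ⟨a, b⟩ | ⟨a, b⟩
      · exact absurd (by rw [← a]; rfl) hne
      · omega

end SimpleGraph

/-! ### Finding chordless cycles, and what can be attached to them. -/

namespace SimpleGraph

variable {V : Type*} {G : SimpleGraph V}

theorem within_mono {T T' : Set V} (h : T ⊆ T') : G.within T ≤ G.within T' :=
  fun _ _ hxy => ⟨hxy.1, h hxy.2.1, h hxy.2.2⟩

/-- The edge `uv` closes a shortest path from `v` to `u` that avoids it. A chord would shorten the
path, and length two would give a triangle. -/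
theorem exists_chordlessCycle (htri : G.CliqueFree 3) {T : Set V} {u v : V} (hu : u ∈ T)
    (huv : G.Adj u v)
    (hr : ((G.within T).deleteEdges {s(u, v)}).Reachable v u) :
    ∃ n p, G.IsChordlessCycle n p ∧ p 0 = v ∧ p (n - 1) = u ∧ ∀ i < n, p i ∈ T := by
  set G' := (G.within T).deleteEdges {s(u, v)} with hG'
  have hadj : ∀ {a b}, G'.Adj a b ↔ (G.Adj a b ∧ a ∈ T ∧ b ∈ T) ∧ s(a, b) ≠ s(u, v) := by
    intro a b; rw [hG', deleteEdges_adj]; rfl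
  obtain ⟨w, hw⟩ := hr.exists_walk_length_eq_dist
  set m := G'.dist v u with hm
  have hreach : ∀ i, G'.Reachable v (w.getVert i) := fun i => ⟨w.take i⟩
  have hdist : ∀ i ≤ m, G'.dist v (w.getVert i) = i := by
    intro i hi
    apply le_antisymm
    · refine (dist_le (w.take i)).trans ?_
      rw [Walk.take_length]; omega
    · obtain ⟨q, hq⟩ := (hreach i).exists_walk_length_eq_dist
      have h1 := dist_le (q.append (w.drop i))
      rw [Walk.length_append, Walk.drop_length, hq, ← hm] at h1
      omega
  have hinj : ∀ i ≤ m, ∀ j ≤ m, w.getVert i = w.getVert j → i = j := fun i hi j hj e => by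
    rw [← hdist i hi, ← hdist j hj, e]
  have h0 : w.getVert 0 = v := w.getVert_zero
  have hlast : w.getVert m = u := by rw [← hw]; exact w.getVert_length
  have hstep : ∀ i < m, G'.Adj (w.getVert i) (w.getVert (i + 1)) := fun i hi =>
    w.adj_getVert_succ (by omega)
  have hm3 : 3 ≤ m := by
    by_contra hlt
    have : m = 0 ∨ m = 1 ∨ m = 2 := by omega
    rcases this with h | h | h
    · rw [h, h0] at hlast; exact huv.ne hlast.symm
    · have := hstep 0 (by omega)
      rw [h] at hlast
      rw [h0, zero_add, hlast, hadj] at this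
      exact this.2 Sym2.eq_swap
    · have a1 := hstep 0 (by omega)
      have a2 := hstep 1 (by omega)
      rw [h] at hlast
      rw [h0, hadj] at a1
      rw [show 1 + 1 = 2 from rfl, hlast, hadj] at a2
      classical
      exact htri _ (is3Clique_iff.2 ⟨v, w.getVert 1, u, a1.1.1, huv.symm, a2.1.1, rfl⟩)
  have hforward : ∀ i j, i < j → j ≤ m → G.Adj (w.getVert i) (w.getVert j) →
      j = i + 1 ∨ (i = 0 ∧ j = m) := by
    intro i j hij hj h
    by_cases hs : s(w.getVert i, w.getVert j) = s(u, v)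
    · rcases Sym2.eq_iff.1 hs with ⟨e1, e2⟩ | ⟨e1, e2⟩
      · have := hinj i (by omega) m le_rfl (e1.trans hlast.symm); omega
      · exact .inr ⟨hinj i (by omega) 0 (by omega) (e1.trans h0.symm),
          hinj j hj m le_rfl (e2.trans hlast.symm)⟩
    · have hT : ∀ k ≤ m, w.getVert k ∈ T := by
        intro k hk
        rcases Nat.lt_or_ge k m with hk' | hk'
        · exact (hadj.1 (hstep k hk')).1.2.1
        · obtain rfl : k = m := by omega
          rw [hlast]; exact hu
      have h' : G'.Adj (w.getVert i) (w.getVert j) :=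
        hadj.2 ⟨⟨h, hT i (by omega), hT j hj⟩, hs⟩
      obtain ⟨q, hq⟩ := (hreach i).exists_walk_length_eq_dist
      have := dist_le (q.concat h')
      rw [Walk.length_concat, hq, hdist i (by omega), hdist j hj] at this
      omega
  have hback : ∀ i < m + 1, G.Adj (w.getVert i) (w.getVert (cycleNext (m + 1) i)) := by
    intro i hi
    rcases cycleNext_cases hi with ⟨a, b⟩ | ⟨a, b⟩
    · obtain rfl : i = m := by omega
      rw [b, hlast, h0]; exact huv
    · rw [b]; exact (hadj.1 (hstep i (by omega))).1.1
  have hone : ∀ i j, i < j → j ≤ m → G.Adj (w.getVert i) (w.getVert j) →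
      j = cycleNext (m + 1) i ∨ i = cycleNext (m + 1) j := by
    intro i j hij hj h
    rcases hforward i j hij hj h with h1 | ⟨h1, h2⟩
    · left
      rcases cycleNext_cases (show i < m + 1 by omega) with ⟨a, b⟩ | ⟨a, b⟩ <;> omega
    · right
      rcases cycleNext_cases (show j < m + 1 by omega) with ⟨a, b⟩ | ⟨a, b⟩ <;> omega
  refine ⟨m + 1, w.getVert, ⟨by omega, fun i hi j hj => hinj i (by omega) j (by omega),
    fun i hi j hj => ⟨fun h => ?_, ?_⟩⟩, h0, by simpa using hlast, fun i hi => ?_⟩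
  · rcases lt_trichotomy i j with hij | rfl | hij
    · exact hone i j hij (by omega) h
    · exact absurd h (G.irrefl)
    · exact (hone j i hij (by omega) h.symm).symm
  · rintro (rfl | rfl)
    · exact hback i hi
    · exact (hback j hj).symm
  · rcases Nat.lt_or_ge i m with hk' | hk'
    · exact (hadj.1 (hstep i hk')).1.2.1
    · obtain rfl : i = m := by omega
      rw [hlast]; exact hu

variable {n : ℕ} {p : ℕ → V}

theorem IsChordlessCycle.adj_succ (h : G.IsChordlessCycle n p) {i : ℕ} (hi : i + 1 < n) :
    G.Adj (p i) (p (i + 1)) := by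
  rw [h.adj_iff i (by omega) _ hi]
  left
  rcases cycleNext_cases (show i < n by omega) with ⟨a, b⟩ | ⟨a, b⟩ <;> omega

theorem IsChordlessCycle.adj_last (h : G.IsChordlessCycle n p) : G.Adj (p (n - 1)) (p 0) := by
  have := h.four_le
  rw [h.adj_iff _ (by omega) _ (by omega)]
  left
  rcases cycleNext_cases (show n - 1 < n by omega) with ⟨a, b⟩ | ⟨a, b⟩ <;> omega

theorem IsChordlessCycle.reachable_segment (h : G.IsChordlessCycle n p) {T : Set V} {i j : ℕ}
    (hij : i ≤ j) (hj : j < n) (hT : ∀ k, i ≤ k → k ≤ j → p k ∈ T) :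
    (G.within T).Reachable (p i) (p j) := by
  induction j, hij using Nat.le_induction with
  | base => exact Reachable.refl _
  | succ j hij ih =>
    refine (ih (by omega) fun k h1 h2 => hT k h1 (by omega)).trans (Adj.reachable ?_)
    exact ⟨h.adj_succ hj, hT j hij (by omega), hT (j + 1) (by omega) le_rfl⟩

/-- In an outerplanar graph, a connected set of vertices outside a chordless cycle cannot be
attached to two vertices of the cycle that are not adjacent. -/
theorem IsChordlessCycle.not_attached [Finite V] (hout : G.IsOuterplanar)
    (h : G.IsChordlessCycle n p) {D : Set V} (hD : ∀ y ∈ D, ∀ z ∈ D, (G.within D).Reachable y z)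
    (hpD : ∀ i < n, p i ∉ D) {i j : ℕ} (hij : i < j) (hj : j < n) (hnadj : ¬ G.Adj (p i) (p j))
    {y z : V} (hy : y ∈ D) (hz : z ∈ D) (hiy : G.Adj (p i) y) (hjz : G.Adj (p j) z) : False := by
  have hn := h.four_le
  have hij1 : j ≠ i + 1 := by rintro rfl; exact hnadj (h.adj_succ hj)
  have hlast : i = 0 → j ≠ n - 1 := by rintro rfl rfl; exact hnadj h.adj_last.symm
  have hp : ∀ {k l}, k < n → l < n → p k = p l → k = l := fun hk hl => h.injOn _ hk _ hl
  -- The K₂,₃ has hubs `p i`, `p j`; its middle branch sets are the two open arcs of the cycle,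
  -- nonempty by non-adjacency, and `D`.
  let X₀ : Set V := p '' {k | i < k ∧ k < j}
  let X₁ : Set V := p '' {k | k < n ∧ (k < i ∨ j < k)}
  have m₀ : ∀ k, i < k → k < j → p k ∈ X₀ := fun k h1 h2 => ⟨k, ⟨h1, h2⟩, rfl⟩
  have m₁ : ∀ k, k < n → (k < i ∨ j < k) → p k ∈ X₁ := fun k h1 h2 => ⟨k, ⟨h1, h2⟩, rfl⟩
  -- This arc wraps around through index 0. Its vertex next to `p j` is `p (j + 1)`, or `p 0` if `j
  -- = n - 1`.
  have hX₁ : ∃ x ∈ X₁, (G.within (insert (p i) X₁)).Reachable (p i) x ∧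
      (G.within (insert (p j) X₁)).Reachable (p j) x := by
    by_cases hjn : j + 1 < n
    · refine ⟨p (j + 1), m₁ _ hjn (.inr (by omega)), ?_, Adj.reachable ⟨h.adj_succ hjn, .inl rfl,
        .inr (m₁ _ hjn (.inr (by omega)))⟩⟩
      have m : ∀ k, k < n → (k ≤ i ∨ j < k) → p k ∈ insert (p i) X₁ := by
        intro k hk hk'
        by_cases e : k = i
        · exact .inl (by rw [e])
        · exact .inr (m₁ k hk (by omega))
      have r1 := h.reachable_segment (T := insert (p i) X₁) (Nat.zero_le i) (by omega)
        fun k _ hk => m k (by omega) (.inl hk)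
      have r2 := h.reachable_segment (T := insert (p i) X₁) (show j + 1 ≤ n - 1 by omega) (by omega)
        fun k hk hk' => m k (by omega) (.inr (by omega))
      have r3 : (G.within (insert (p i) X₁)).Adj (p (n - 1)) (p 0) :=
        ⟨h.adj_last, m _ (by omega) (.inr (by omega)), m _ (by omega) (.inl (by omega))⟩
      exact ((r2.trans r3.reachable).trans r1).symm
    · obtain rfl : j = n - 1 := by omega
      have hi0 : 0 < i := Nat.pos_of_ne_zero fun e => hlast e rfl
      refine ⟨p 0, m₁ 0 (by omega) (.inl hi0), ?_, Adj.reachable ⟨h.adj_last, .inl rfl,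
        .inr (m₁ 0 (by omega) (.inl hi0))⟩⟩
      refine (h.reachable_segment (Nat.zero_le i) (by omega) fun k _ hk => ?_).symm
      by_cases e : k = i
      · exact .inl (by rw [e])
      · exact .inr (m₁ k (by omega) (by omega))
  obtain ⟨x₁, hx₁, hr₁, hr₁'⟩ := hX₁
  have d01 : Disjoint X₀ X₁ := by
    refine Set.disjoint_left.2 ?_
    rintro _ ⟨k, ⟨k1, k2⟩, rfl⟩ ⟨l, ⟨l1, l2⟩, e⟩
    have := hp l1 (by omega) e
    omega
  have d02 : Disjoint X₀ D := by
    refine Set.disjoint_left.2 ?_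
    rintro _ ⟨k, ⟨k1, k2⟩, rfl⟩ hk
    exact hpD k (by omega) hk
  have d12 : Disjoint X₁ D := by
    refine Set.disjoint_left.2 ?_
    rintro _ ⟨k, ⟨k1, k2⟩, rfl⟩ hk
    exact hpD k k1 hk
  have n₀ : ∀ l < n, (l = i ∨ l = j) → p l ∉ X₀ := by
    rintro l hl hl' ⟨k, ⟨k1, k2⟩, e⟩
    have := hp (by omega) hl e
    omega
  have n₁ : ∀ l < n, (l = i ∨ l = j) → p l ∉ X₁ := by
    rintro l hl hl' ⟨k, ⟨k1, k2⟩, e⟩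
    have := hp k1 hl e
    omega
  refine hout.not_exists_K23 (a := p i) (b := p j) (fun e => ?_) ![X₀, X₁, D] (fun k l hkl => ?_)
    (fun k => ?_) (fun k => ?_) ![p (i + 1), x₁, y] (fun k => ?_) (fun k => ?_) (fun k => ?_)
  · have := hp (by omega) hj e; omega
  · fin_cases k <;> fin_cases l
    exacts [absurd rfl hkl, d01, d02, d01.symm, absurd rfl hkl, d12, d02.symm, d12.symm,
      absurd rfl hkl]
  · fin_cases k
    exacts [n₀ i (by omega) (.inl rfl), n₁ i (by omega) (.inl rfl), hpD i (by omega)]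
  · fin_cases k
    exacts [n₀ j hj (.inr rfl), n₁ j hj (.inr rfl), hpD j hj]
  · fin_cases k
    exacts [m₀ (i + 1) (by omega) (by omega), hx₁, hy]
  · fin_cases k
    · exact Adj.reachable ⟨h.adj_succ (by omega), .inl rfl, .inr (m₀ _ (by omega) (by omega))⟩
    · exact hr₁
    · exact Adj.reachable ⟨hiy, .inl rfl, .inr hy⟩
  · fin_cases k
    · refine (h.reachable_segment (show i + 1 ≤ j by omega) hj fun k h1 h2 => ?_).symm
      by_cases e : k = j
      · exact .inl (by rw [e])
      · exact .inr (m₀ k (by omega) (by omega))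
    · exact hr₁'
    · have r : (G.within (insert (p j) D)).Adj (p j) z := ⟨hjz, .inl rfl, .inr hz⟩
      exact r.reachable.trans ((hD z hz y hy).mono (within_mono (Set.subset_insert _ _)))

end SimpleGraph

/-! ### The induction. -/

namespace SimpleGraph

variable {V : Type*} {G : SimpleGraph V} {n : ℕ} {p : ℕ → V}

theorem IsChordlessCycle.exists_two_neighbors (h : G.IsChordlessCycle n p) {i : ℕ} (hi : i < n) :
    ∃ j < n, ∃ k < n, p j ≠ p k ∧ G.Adj (p i) (p j) ∧ G.Adj (p i) (p k) := by
  have hn := h.four_le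
  refine ⟨cycleNext n i, cycleNext_lt hi, if i = 0 then n - 1 else i - 1, by split_ifs <;> omega,
    fun e => ?_, ?_, ?_⟩
  · have := h.injOn _ (cycleNext_lt hi) _ (by split_ifs <;> omega) e
    rcases cycleNext_cases hi with ⟨a, b⟩ | ⟨a, b⟩ <;> split_ifs at this <;> omega
  · exact (h.adj_iff _ hi _ (cycleNext_lt hi)).2 (.inl rfl)
  · split_ifs with h0
    · subst h0; exact h.adj_last.symm
    · have := h.adj_succ (i := i - 1) (by omega)
      rw [show i - 1 + 1 = i by omega] at this
      exact this.symm

theorem Extendable.centered {A S : Finset V} {v : V} (hv : v ∈ A) (hA : G.Centered A v)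
    (hext : ∀ c, G.Good A c → G.Extendable A S c) : G.Centered S v := by
  obtain ⟨c, hc, hcv, hcn⟩ := hA
  obtain ⟨c', hc', he, hz⟩ := hext c hc
  exact ⟨c', hc', by rwa [he v hv], fun y hy hvy => hz v hv hcv hcn y hy hvy⟩

variable [DecidableEq V]

/-- A vertex of degree at most `k + 2` on a chordless cycle has at most `k` neighbours outside. -/
theorem IsChordlessCycle.card_le_of_degreeLE (h : G.IsChordlessCycle n p) {S N : Finset V} {k i : ℕ}
    (hi : i < n) (hS : ∀ j < n, p j ∈ S) (hd : G.DegreeLE S (k + 2) (p i)) (hN : N ⊆ S)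
    (hNp : ∀ j < n, p j ∉ N) (hadj : ∀ y ∈ N, G.Adj (p i) y) : N.card ≤ k := by
  obtain ⟨a, ha, b, hb, hab, h1, h2⟩ := h.exists_two_neighbors hi
  have := hd (insert (p a) (insert (p b) N))
    (Finset.insert_subset (hS a ha) (Finset.insert_subset (hS b hb) hN))
    (by
      intro y hy
      simp only [Finset.mem_insert] at hy
      rcases hy with rfl | rfl | hy
      exacts [h1, h2, hadj y hy])
  rw [Finset.card_insert_of_notMem (by simp [hab, hNp a ha]),
    Finset.card_insert_of_notMem (hNp b hb)] at this
  omega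

/-- All good colorings needed for the induction exist on the subgraph induced on `S`. -/
def Reducible (G : SimpleGraph V) (S : Finset V) : Prop :=
  (∀ v ∈ S, G.Centered S v) ∧
    ∀ u ∈ S, ∀ v ∈ S, G.Adj u v → G.DegreeLE S 2 v → G.Paired S u v

variable {S : Finset V}

theorem degreeLE_two_of_unique {D : Finset V} {w w' x : V}
    (hx : ∀ d ∈ D, G.Adj w d → d = x) : G.DegreeLE (insert w (insert w' D)) 2 w := by
  intro N hN hadj
  refine (Finset.card_le_card (t := {w', x}) fun y hy => ?_).trans Finset.card_le_two
  have hy' := hN hy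
  simp only [Finset.mem_insert, Finset.mem_singleton] at hy' ⊢
  rcases hy' with rfl | rfl | hy'
  · exact absurd (hadj _ hy) G.irrefl
  · exact .inl rfl
  · exact .inr (hx y hy' (hadj y hy))

/-- A component `D` of `S` minus the cycle is removed. It is attached to nothing, to one cycle
vertex by a bridge, or to two adjacent cycle vertices. -/
theorem IsChordlessCycle.exists_extendable [Finite V] (hout : G.IsOuterplanar)
    (htri : G.CliqueFree 3) (hdeg : ∀ v, G.DegreeLE S 3 v) (h : G.IsChordlessCycle n p)
    (hS : ∀ i < n, p i ∈ S) (ih : ∀ T ⊂ S, G.Reducible T) {d : V} (hd : d ∈ S)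
    (hdp : ∀ i < n, p i ≠ d) :
    ∃ A ⊂ S, (∀ i < n, p i ∈ A) ∧ ∀ c, G.Good A c → G.Extendable A S c := by
  classical
  let U : Set V := {y | y ∈ S ∧ ∀ i < n, p i ≠ y}
  let D : Finset V := S.filter fun y => y ∈ U ∧ (G.within U).Reachable d y
  have hDmem : ∀ y, y ∈ D ↔ y ∈ U ∧ (G.within U).Reachable d y := fun y => by
    simp only [D, Finset.mem_filter]; exact ⟨fun h => h.2, fun h => ⟨h.1.1, h⟩⟩
  have hDS : D ⊆ S := Finset.filter_subset _ _
  have hdD : d ∈ D := (hDmem d).2 ⟨⟨hd, hdp⟩, Reachable.refl _⟩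
  have hpD : ∀ i < n, p i ∉ D := fun i hi hmem => ((hDmem _).1 hmem).1.2 i hi rfl
  have hAS : S \ D ⊂ S := Finset.sdiff_ssubset hDS ⟨d, hdD⟩
  have hUn : S \ D ∪ D = S := Finset.sdiff_union_of_subset hDS
  have hpA : ∀ i < n, p i ∈ S \ D := fun i hi => Finset.mem_sdiff.2 ⟨hS i hi, hpD i hi⟩
  have hdisj : Disjoint (S \ D) D := Finset.sdiff_disjoint
  have hDssub : D ⊂ S := by
    refine Finset.ssubset_iff_subset_ne.2 ⟨hDS, fun e => ?_⟩
    have := h.four_le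
    exact hpD 0 (by omega) (e ▸ hS 0 (by omega))
  have hedge : ∀ a ∈ S \ D, ∀ y ∈ D, G.Adj a y → ∃ i < n, a = p i := by
    intro a ha y hy hay
    by_contra! hne
    have ha' := Finset.mem_sdiff.1 ha
    have haU : a ∈ U := ⟨ha'.1, fun i hi e => hne i hi e.symm⟩
    obtain ⟨hyU, hr⟩ := (hDmem y).1 hy
    exact ha'.2 ((hDmem a).2 ⟨haU, hr.trans (Adj.reachable ⟨hay.symm, hyU, haU⟩)⟩)
  have hreach : ∀ y z, (G.within U).Reachable y z → y ∈ D →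
      (G.within (D : Set V)).Reachable y z := by
    rintro y z ⟨w⟩ hy
    induction w with
    | nil => exact Reachable.refl _
    | cons hadj _ ihw =>
      have hb := (hDmem _).2 ⟨hadj.2.2, ((hDmem _).1 hy).2.trans (Adj.reachable hadj)⟩
      have hstep : (G.within (D : Set V)).Adj _ _ := ⟨hadj.1, hy, hb⟩
      exact hstep.reachable.trans (ihw hb)
  have hconn : ∀ y ∈ (D : Set V), ∀ z ∈ (D : Set V), (G.within (D : Set V)).Reachable y z :=
    fun y hy z hz => hreach y z (((hDmem y).1 hy).2.symm.trans ((hDmem z).1 hz).2) hy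
  have huniq : ∀ i < n, ∀ y ∈ D, ∀ z ∈ D, G.Adj (p i) y → G.Adj (p i) z → y = z := by
    intro i hi y hy z hz hiy hiz
    have := h.card_le_of_degreeLE (k := 1) hi hS (hdeg _) (N := {y, z})
      (by simp [Finset.insert_subset_iff, hDS hy, hDS hz])
      (by
        intro j hj hmem
        simp only [Finset.mem_insert, Finset.mem_singleton] at hmem
        rcases hmem with e | e
        exacts [hpD j hj (e ▸ hy), hpD j hj (e ▸ hz)])
      (by simp [hiy, hiz])
    exact Finset.card_le_one.1 this y (by simp) z (by simp)
  have hadj : ∀ i < n, ∀ j < n, i ≠ j → ∀ y ∈ D, ∀ z ∈ D, G.Adj (p i) y → G.Adj (p j) z →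
      G.Adj (p i) (p j) := by
    intro i hi j hj hij y hy z hz hiy hjz
    by_contra hn
    rcases Nat.lt_or_gt_of_ne hij with hlt | hlt
    · exact h.not_attached hout hconn hpD hlt hj hn hy hz hiy hjz
    · exact h.not_attached hout hconn hpD hlt hi (fun e => hn e.symm) hz hy hjz hiy
  refine ⟨S \ D, hAS, hpA, fun c hc => ?_⟩
  have hCD := (ih D hDssub).1
  by_cases hatt : ∀ a ∈ S \ D, ∀ y ∈ D, ¬ G.Adj a y
  · obtain ⟨c', hc', -⟩ := hCD d hdD
    have := extendable_of_not_adj hc hc' hdisj hatt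
    rwa [hUn] at this
  push Not at hatt
  obtain ⟨w, hw, x, hx, hwx⟩ := hatt
  obtain ⟨i, hi, rfl⟩ := hedge w hw x hx hwx
  by_cases hone : ∀ a ∈ S \ D, ∀ y ∈ D, G.Adj a y → a = p i
  · have := extendable_of_bridge hc hdisj hw hx hwx (fun a ha y hy hay => by
      obtain rfl := hone a ha y hy hay
      exact ⟨rfl, huniq i hi y hy x hx hay hwx⟩) (by rw [hUn]; exact hdeg _)
      (by rw [hUn]; exact hdeg _) hCD
    rwa [hUn] at this
  push Not at hone
  obtain ⟨w', hw', x', hx', hwx', hne⟩ := hone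
  obtain ⟨j, hj, rfl⟩ := hedge w' hw' x' hx' hwx'
  have hij : i ≠ j := fun e => hne (by rw [e])
  have hww' := hadj i hi j hj hij x hx x' hx' hwx hwx'
  have hatt : G.AttachedAt (S \ D) D (p i) (p j) x x' := by
    refine ⟨hdisj, hw, hw', hx, hx', hww', hwx, hwx', fun a ha y hy hay => ?_⟩
    obtain ⟨k, hk, rfl⟩ := hedge a ha y hy hay
    by_cases hki : k = i
    · subst hki; exact .inl ⟨rfl, huniq k hk y hy x hx hay hwx⟩
    by_cases hkj : k = j
    · subst hkj; exact .inr ⟨rfl, huniq k hk y hy x' hx' hay hwx'⟩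
    -- A third attachment vertex would form a triangle with the other two.
    exact absurd (is3Clique_iff.2 ⟨p k, p i, p j, hadj k hk i hi hki y hy x hx hay hwx,
      hadj k hk j hj hkj y hy x' hx' hay hwx', hww', rfl⟩) (htri _)
  have hHsub : insert (p i) (insert (p j) D) ⊆ S :=
    Finset.insert_subset (hS i hi) (Finset.insert_subset (hS j hj) hDS)
  have hHss : insert (p i) (insert (p j) D) ⊂ S := by
    refine Finset.ssubset_iff_subset_ne.2 ⟨hHsub, fun e => ?_⟩
    have hn := h.four_le
    -- A further cycle vertex lies in `S` but outside the attached piece, so induction applies to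
    -- that piece.
    obtain ⟨k, hk, hki, hkj⟩ : ∃ k < n, k ≠ i ∧ k ≠ j := by
      by_cases h0 : 0 ≠ i ∧ 0 ≠ j
      · exact ⟨0, by omega, h0⟩
      by_cases h1 : 1 ≠ i ∧ 1 ≠ j
      · exact ⟨1, by omega, h1⟩
      exact ⟨2, by omega, by omega, by omega⟩
    have := hS k hk
    rw [← e] at this
    simp only [Finset.mem_insert] at this
    rcases this with e | e | e
    · exact hki (h.injOn k hk i hi e)
    · exact hkj (h.injOn k hk j hj e)
    · exact hpD k hk e
  have hH := ih _ hHss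
  have mi : p i ∈ insert (p i) (insert (p j) D) := by simp
  have mj : p j ∈ insert (p i) (insert (p j) D) := by simp
  have di : G.DegreeLE (insert (p i) (insert (p j) D)) 2 (p i) :=
    degreeLE_two_of_unique fun y hy hiy => huniq i hi y hy x hx hiy hwx
  have dj : G.DegreeLE (insert (p i) (insert (p j) D)) 2 (p j) := by
    rw [Finset.insert_comm]
    exact degreeLE_two_of_unique fun y hy hjy => huniq j hj y hy x' hx' hjy hwx'
  have := hatt.extendable hc (by rw [hUn]; exact hdeg _) (by rw [hUn]; exact hdeg _) hH.1
    (hH.2 _ mi _ mj hww' dj) (hH.2 _ mj _ mi hww'.symm di)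
  rwa [hUn] at this

theorem IsChordlessCycle.eq_image (hS : ∀ i < n, p i ∈ S) (hne : ¬ ∃ d ∈ S, ∀ i < n, p i ≠ d) :
    S = (Finset.range n).image p := by
  push Not at hne
  ext y
  simp only [Finset.mem_image, Finset.mem_range]
  constructor
  · exact fun hy => hne y hy
  · rintro ⟨i, hi, rfl⟩; exact hS i hi

/-- The vertices on the side of `x` of a bridge `vx`. -/
theorem exists_bridge_side {v x : V} (hx : x ∈ S)
    (hnr : ¬ ((G.within (S : Set V)).deleteEdges {s(x, v)}).Reachable v x) :
    ∃ D ⊆ S, x ∈ D ∧ v ∉ D ∧ ∀ a ∈ S \ D, ∀ d ∈ D, G.Adj a d → a = v ∧ d = x := by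
  classical
  set G' := (G.within (S : Set V)).deleteEdges {s(x, v)} with hG'
  refine ⟨S.filter fun y => G'.Reachable x y, Finset.filter_subset _ _,
    Finset.mem_filter.2 ⟨hx, Reachable.refl _⟩, fun h => hnr (Finset.mem_filter.1 h).2.symm,
    fun a ha d hd had => ?_⟩
  simp only [Finset.mem_sdiff, Finset.mem_filter, not_and] at ha hd
  have hna := ha.2 ha.1
  by_contra hne
  have hs : s(d, a) ≠ s(x, v) := by
    intro e
    rcases Sym2.eq_iff.1 e with ⟨e1, e2⟩ | ⟨e1, e2⟩
    · exact hne ⟨e2, e1⟩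
    · exact hna (e2 ▸ Reachable.refl _)
  refine hna (hd.2.trans (Adj.reachable ?_))
  rw [hG', deleteEdges_adj]
  exact ⟨⟨had.symm, hd.1, ha.1⟩, hs⟩

theorem reducible [Finite V] (hout : G.IsOuterplanar) (htri : G.CliqueFree 3)
    (hdeg : ∀ (S : Finset V) v, G.DegreeLE S 3 v) (S : Finset V) : G.Reducible S := by
  induction S using Finset.strongInduction with
  | H S ih =>
  refine ⟨fun v hv => ?_, fun u hu v hv huv hdv => ?_⟩
  · by_cases hx : ∃ x ∈ S, G.Adj x v
    · obtain ⟨x, hx, hxv⟩ := hx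
      by_cases hr : ((G.within (S : Set V)).deleteEdges {s(x, v)}).Reachable v x
      · obtain ⟨n, p, h, h0, -, hpS⟩ := exists_chordlessCycle htri hx hxv hr
        have hpos := h.four_le
        by_cases hd : ∃ d ∈ S, ∀ i < n, p i ≠ d
        · obtain ⟨d, hd, hdp⟩ := hd
          obtain ⟨A, hA, hpA, hext⟩ := h.exists_extendable hout htri (hdeg S) hpS ih hd hdp
          have hvA : v ∈ A := h0 ▸ hpA 0 (by omega)
          exact Extendable.centered hvA ((ih A hA).1 v hvA) hext
        · rw [IsChordlessCycle.eq_image hpS hd, ← h0]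
          exact h.centered
      · obtain ⟨D, hDS, hxD, hvD, hedge⟩ := exists_bridge_side hx hr
        have hUn : S \ D ∪ D = S := Finset.sdiff_union_of_subset hDS
        have hvA : v ∈ S \ D := Finset.mem_sdiff.2 ⟨hv, hvD⟩
        have hDss : D ⊂ S := Finset.ssubset_iff_subset_ne.2 ⟨hDS, fun e => hvD (e ▸ hv)⟩
        refine Extendable.centered hvA ((ih _ (Finset.sdiff_ssubset hDS ⟨x, hxD⟩)).1 v hvA)
          fun c hc => ?_
        have := extendable_of_bridge hc Finset.sdiff_disjoint hvA hxD hxv.symm hedge (hdeg _ _)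
          (hdeg _ _) (ih D hDss).1
        rwa [hUn] at this
    · push Not at hx
      have hsingle : G.Centered {v} v := by
        refine ⟨fun _ => 1, ⟨?_, ?_, ?_⟩, one_ne_zero, ?_⟩
        · simp
        · simp
        · simp
        · simp
      by_cases hS : S = {v}
      · rw [hS]; exact hsingle
      have hvS : {v} ⊂ S :=
        Finset.ssubset_iff_subset_ne.2 ⟨Finset.singleton_subset_iff.2 hv, fun e => hS e.symm⟩
      obtain ⟨y, hy, hyv⟩ := Finset.exists_of_ssubset hvS
      refine Extendable.centered (Finset.mem_singleton_self v) hsingle fun c hc => ?_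
      have hss : S \ {v} ⊂ S := Finset.sdiff_ssubset hvS.1 ⟨v, by simp⟩
      obtain ⟨c', hc', -⟩ := (ih _ hss).1 y (Finset.mem_sdiff.2 ⟨hy, hyv⟩)
      have := extendable_of_not_adj hc hc' Finset.disjoint_sdiff (fun a ha d hd had => by
        rw [Finset.mem_singleton] at ha
        exact hx d (Finset.mem_sdiff.1 hd).1 (ha ▸ had.symm))
      rwa [Finset.union_sdiff_of_subset hvS.1] at this
  · by_cases hr : ((G.within (S : Set V)).deleteEdges {s(u, v)}).Reachable v u
    · obtain ⟨n, p, h, h0, hlast, hpS⟩ := exists_chordlessCycle htri hu huv hr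
      have hpos := h.four_le
      by_cases hd : ∃ d ∈ S, ∀ i < n, p i ≠ d
      · obtain ⟨d, hd, hdp⟩ := hd
        obtain ⟨A, hA, hpA, hext⟩ := h.exists_extendable hout htri (hdeg S) hpS ih hd hdp
        have hvA : v ∈ A := h0 ▸ hpA 0 (by omega)
        have huA : u ∈ A := hlast ▸ hpA (n - 1) (by omega)
        obtain ⟨c, hc, hcu, hcv, hcn⟩ := (ih A hA).2 u huA v hvA huv (hdv.mono hA.1)
        obtain ⟨c', hc', he, -⟩ := hext c hc
        refine ⟨c', hc', by rwa [he u huA], by rwa [he v hvA], fun y hy hvy hyu => ?_⟩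
        -- Since `v` has degree at most two, all its neighbors lie on the cycle, hence in `A`, where
        -- colors do not change.
        have hyp : ∃ j < n, p j = y := by
          by_contra! hyp
          have := h.card_le_of_degreeLE (k := 0) (i := 0) (by omega) hpS (by rwa [h0]) (N := {y})
            (by simpa using hy) (by simpa using hyp) (by simpa [h0] using hvy)
          simp at this
        obtain ⟨j, hj, rfl⟩ := hyp
        rw [he _ (hpA j hj)]
        exact hcn _ (hpA j hj) hvy hyu
      · rw [IsChordlessCycle.eq_image hpS hd, ← h0, ← hlast]
        exact h.paired
    · rw [Sym2.eq_swap, reachable_comm] at hr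
      obtain ⟨D, hDS, hvD, huD, hedge⟩ := exists_bridge_side hv hr
      have hUn : S \ D ∪ D = S := Finset.sdiff_union_of_subset hDS
      have huA : u ∈ S \ D := Finset.mem_sdiff.2 ⟨hu, huD⟩
      have hDss : D ⊂ S := Finset.ssubset_iff_subset_ne.2 ⟨hDS, fun e => huD (e ▸ hu)⟩
      have := paired_of_bridge Finset.sdiff_disjoint huA hvD hedge
        ((ih _ (Finset.sdiff_ssubset hDS ⟨v, hvD⟩)).1 u huA) ((ih D hDss).1 v hvD)
      rwa [hUn] at this

end SimpleGraph

/-! ### From good colorings to packing colorings. -/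

theorem theorem3 {V : Type*} [Fintype V] (G : SimpleGraph V) [DecidableRel G.Adj]
    (hsub : G.IsSubcubic) (hout : G.IsOuterplanar) (htri : G.CliqueFree 3) :
    G.IsPackingColorable ![1, 2, 2, 2] := by
  classical
  have hdeg : ∀ (S : Finset V) v, G.DegreeLE S 3 v := fun S v N _ hN =>
    (Finset.card_le_card fun y hy => (G.mem_neighborFinset v y).2 (hN y hy)).trans
      ((G.card_neighborFinset_eq_degree v).le.trans (hsub v))
  obtain ⟨c, hc⟩ : ∃ c, G.Good Finset.univ c := by
    rcases isEmpty_or_nonempty V with hV | ⟨⟨v⟩⟩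
    · exact ⟨fun _ => 0, fun x => isEmptyElim x, fun x => isEmptyElim x, fun x => isEmptyElim x⟩
    · obtain ⟨c, hc, -⟩ := (G.reducible hout htri hdeg Finset.univ).1 v (Finset.mem_univ v)
      exact ⟨c, hc⟩
  have m : ∀ y : V, y ∈ Finset.univ := Finset.mem_univ
  refine ⟨c, fun i x hx y hy hxy => ?_⟩
  have e : c x = c y := Eq.trans hx (Eq.symm hy)
  have hnadj : ¬ G.Adj x y := fun h => hc.proper x (m x) y (m y) h e
  have hne : i ≠ 0 → ∀ z, G.Adj x z → ¬ G.Adj z y := fun hi z hxz hzy =>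
    hi ((Eq.symm hx).trans (hc.square x (m x) z (m z) y (m y) hxz hzy hxy e))
  have hwalk : ∀ w : G.Walk x y, (![1, 2, 2, 2] i : ℕ) < w.length := by
    intro w
    cases w with
    | nil => exact absurd rfl hxy
    | cons h w =>
      cases w with
      | nil => exact absurd h hnadj
      | cons h' w =>
        by_cases hi : i = 0
        · subst hi; simp
        · have h2 : (![1, 2, 2, 2] i : ℕ) = 2 := by
            revert hi; fin_cases i <;> simp
          rw [h2]
          cases w with
          | nil => exact absurd h' (hne hi _ h)
          | cons h'' w => simp
  by_cases hr : G.Reachable x y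
  · obtain ⟨w, hw⟩ := hr.exists_walk_length_eq_edist
    rw [← hw]
    exact_mod_cast hwalk w
  · rw [SimpleGraph.edist_eq_top_of_not_reachable hr]
    exact ENat.natCast_lt_top _
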